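/- Let $\mathbf{emTT}$ be the extensional level of the Minimalist Foundation: the extensional dependent type theory with four kinds of types (small propositions, propositions, sets, collections; small propositions are propositions and sets, and propositions and sets are collections), with the sets $\mathsf{N_0}$, $\mathsf{N_1}$, dependent sums and products, disjoint sums, lists and effective quotients by small equivalence relations, with dependent sums of collections, the power collection $\mathcal{P}(1)$ of small propositions up to equiprovability and the power collections $A\to\mathcal{P}(1)$ of sets $A$, and with proof-irrelevant intuitionistic propositions $\bot,\wedge,\vee,\Rightarrow,\exists,\forall,\mathsf{Eq}$ with canonical proof-term $\mathsf{true}$ and equality reflection. Let $\mathbf{emTT}_{\mathsf{imp}}$ be the extension of $\mathbf{emTT}$ by the resizing rules "if $A\;col$ then $A\;set$" and "if $\varphi\;prop$ then $\varphi\;prop_s$", and let $\mathbf{emTT}^c_{\mathsf{imp}}$ be the extension of $\mathbf{emTT}_{\mathsf{imp}}$ by the Law of Excluded Middle "if $\varphi\;prop$ then $\mathsf{true}\in\varphi\vee\neg\varphi$". Let $(-)^{\mathcal{N}}$ be the double-negation translation of the (fully annotated) pre-syntax, which commutes with variables, with $\mathsf{true}$ and with all constructors, and applies recursively to contexts, except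 that $$(\varphi\vee\psi)^{\mathcal N}:\equiv\neg\neg(\varphi^{\mathcal N}\vee\psi^{\mathcal N}),\qquad ((\exists x\in A)\varphi)^{\mathcal N}:\equiv\neg\neg(\exists x\in A^{\mathcal N})\varphi^{\mathcal N},$$ $$\mathcal{P}(1)^{\mathcal N}:\equiv(\Sigma x\in\mathcal{P}(1))(\neg\neg\mathsf{Dc}(x)\Rightarrow\mathsf{Dc}(x)),\qquad [\varphi]^{\mathcal N}:\equiv\langle[\varphi^{\mathcal N}],\mathsf{true}\rangle,$$ where $\mathsf{Dc}(U):\equiv\mathsf{Eq}(\mathcal{P}(1),U,[\top])$. **Proposition.** The theories $\mathbf{emTT}^c_{\mathsf{imp}}$ and $\mathbf{emTT}_{\mathsf{imp}}$ are equiconsistent: $\mathsf{true}\in\bot\;[\,]$ is underivable in one of them if and only if it is underivable in the other. Moreover, the translation $(-)^{\mathcal N}$ is an interpretation of $\mathbf{emTT}^c_{\mathsf{imp}}$ into $\mathbf{emTT}_{\mathsf{imp}}$: 1. for every judgement $\mathcal{J}$ of one of the forms $\Gamma\;ctx$, $A\;type\;[\Gamma]$, $A=B\;type\;[\Gamma]$,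 $a\in A\;[\Gamma]$, $a=b\in A\;[\Gamma]$ (with $type$ any of the four kinds), if $\mathbf{emTT}^c_{\mathsf{imp}}\vdash\mathcal{J}$ then $\mathbf{emTT}_{\mathsf{imp}}\vdash\mathcal{J}^{\mathcal N}$, where $\mathcal{J}^{\mathcal N}$ is obtained by translating all the expressions in $\mathcal{J}$; 2. if $\mathbf{emTT}^c_{\mathsf{imp}}\vdash\varphi\;prop\;[\Gamma]$, then $\mathbf{emTT}_{\mathsf{imp}}\vdash\mathsf{true}\in\neg\neg\varphi^{\mathcal N}\Rightarrow\varphi^{\mathcal N}\;[\Gamma^{\mathcal N}]$; 3. if $\mathbf{emTT}^c_{\mathsf{imp}}\vdash A\;col\;[\Gamma]$, then $\mathbf{emTT}_{\mathsf{imp}}\vdash\mathsf{true}\in\neg\neg\mathsf{Eq}(A^{\mathcal N},x,y)\Rightarrow\mathsf{Eq}(A^{\mathcal N},x,y)\;[\Gamma^{\mathcal N},x\in A^{\mathcal N},y\in A^{\mathcal N}]$. -/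

import Mathlib

/-!
The extensional type theory emTT (the extensional level of the Minimalist Foundation), its
extensions by excluded middle and by the resizing rules, and the double-negation translation.
Expressions are fully annotated and use de Bruijn indices: `var 0` is the variable bound last.
-/

namespace EmTT

/-! ### Pre-syntax -/

/-- Pre-types, pre-propositions and pre-terms. A comment `(x. e)` marks the arguments that live
under binders; in `(x, y. e)` the variable `y` is `var 0` and `x` is `var 1`. -/
inductive Expr : Type
  /-- variables -/
  | var (n : ℕ)
  /-- the empty set `N₀` -/
  | empty
  /-- `El_{N₀}(c)` towards `(z. M)` -/
  | elEmpty (M c : Expr)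
  /-- the singleton set `N₁` -/
  | unit
  /-- the element of `N₁` -/
  | star
  /-- `El_{N₁}(t, c)` towards `(z. M)` -/
  | elUnit (M t c : Expr)
  /-- the dependent sum `(Σ x ∈ A) B`, with `(x. B)` -/
  | sig (A B : Expr)
  /-- the pair `⟨a, b⟩` of type `(Σ x ∈ A) B` -/
  | pair (A B a b : Expr)
  /-- `El_Σ(d, (x, y. m))` towards `(z. M)` -/
  | elSig (A B M d m : Expr)
  /-- the dependent product `(Π x ∈ A) B`, with `(x. B)` -/
  | pi (A B : Expr)
  /-- `(λ x ∈ A) b` of type `(Π x ∈ A) B`, with `(x. b)` -/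
  | lam (A B b : Expr)
  /-- `Ap(f, a)` with `f` of type `(Π x ∈ A) B` -/
  | ap (A B f a : Expr)
  /-- the disjoint sum `A + B` -/
  | sum (A B : Expr)
  /-- the left injection -/
  | inl (A B a : Expr)
  /-- the right injection -/
  | inr (A B b : Expr)
  /-- `El_+(d, (x. l), (y. r))` towards `(z. M)` -/
  | elSum (A B M d l r : Expr)
  /-- the set `List(A)` -/
  | list (A : Expr)
  /-- the empty list -/
  | nil (A : Expr)
  /-- `cons(s, a)`: the list `s` extended by `a` -/
  | cons (A s a : Expr)
  /-- `El_List(s, a, (x, y, z. l))` towards `(z. M)` -/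
  | elList (A M s a l : Expr)
  /-- the quotient set `A / R`, with `(x, y. R)` -/
  | quo (A R : Expr)
  /-- the class `[a]` in `A / R` -/
  | cls (A R a : Expr)
  /-- `El_Q(s, (x. l))` towards `(z. M)` -/
  | elQuo (A R M s l : Expr)
  /-- the power collection `P(1)` of the singleton -/
  | pow
  /-- the class `[φ]` of a small proposition in `P(1)` -/
  | code (φ : Expr)
  /-- falsum -/
  | bot
  /-- conjunction -/
  | and (φ ψ : Expr)
  /-- disjunction -/
  | or (φ ψ : Expr)
  /-- implication -/
  | imp (φ ψ : Expr)
  /-- `(∃ x ∈ A) φ`, with `(x. φ)` -/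
  | ex (A φ : Expr)
  /-- `(∀ x ∈ A) φ`, with `(x. φ)` -/
  | all (A φ : Expr)
  /-- propositional equality `Eq(A, a, b)` -/
  | eq (A a b : Expr)
  /-- the canonical proof-term `true` -/
  | tt

/-! ### Renaming and substitution -/

/-- A renaming going under one binder. -/
def upRen (ρ : ℕ → ℕ) : ℕ → ℕ
  | 0 => 0
  | n + 1 => ρ n + 1

namespace Expr

/-- Renaming of variables. -/
def ren : (ℕ → ℕ) → Expr → Expr
  | ρ, var n => var (ρ n)
  | _, empty => empty
  | ρ, elEmpty M c => elEmpty (ren (upRen ρ) M) (ren ρ c)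
  | _, unit => unit
  | _, star => star
  | ρ, elUnit M t c => elUnit (ren (upRen ρ) M) (ren ρ t) (ren ρ c)
  | ρ, sig A B => sig (ren ρ A) (ren (upRen ρ) B)
  | ρ, pair A B a b => pair (ren ρ A) (ren (upRen ρ) B) (ren ρ a) (ren ρ b)
  | ρ, elSig A B M d m =>
      elSig (ren ρ A) (ren (upRen ρ) B) (ren (upRen ρ) M) (ren ρ d) (ren (upRen (upRen ρ)) m)
  | ρ, pi A B => pi (ren ρ A) (ren (upRen ρ) B)
  | ρ, lam A B b => lam (ren ρ A) (ren (upRen ρ) B) (ren (upRen ρ) b)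
  | ρ, ap A B f a => ap (ren ρ A) (ren (upRen ρ) B) (ren ρ f) (ren ρ a)
  | ρ, sum A B => sum (ren ρ A) (ren ρ B)
  | ρ, inl A B a => inl (ren ρ A) (ren ρ B) (ren ρ a)
  | ρ, inr A B b => inr (ren ρ A) (ren ρ B) (ren ρ b)
  | ρ, elSum A B M d l r =>
      elSum (ren ρ A) (ren ρ B) (ren (upRen ρ) M) (ren ρ d) (ren (upRen ρ) l) (ren (upRen ρ) r)
  | ρ, list A => list (ren ρ A)
  | ρ, nil A => nil (ren ρ A)
  | ρ, cons A s a => cons (ren ρ A) (ren ρ s) (ren ρ a)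
  | ρ, elList A M s a l =>
      elList (ren ρ A) (ren (upRen ρ) M) (ren ρ s) (ren ρ a) (ren (upRen (upRen (upRen ρ))) l)
  | ρ, quo A R => quo (ren ρ A) (ren (upRen (upRen ρ)) R)
  | ρ, cls A R a => cls (ren ρ A) (ren (upRen (upRen ρ)) R) (ren ρ a)
  | ρ, elQuo A R M s l =>
      elQuo (ren ρ A) (ren (upRen (upRen ρ)) R) (ren (upRen ρ) M) (ren ρ s) (ren (upRen ρ) l)
  | _, pow => pow
  | ρ, code φ => code (ren ρ φ)
  | _, bot => bot
  | ρ, and φ ψ => and (ren ρ φ) (ren ρ ψ)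
  | ρ, or φ ψ => or (ren ρ φ) (ren ρ ψ)
  | ρ, imp φ ψ => imp (ren ρ φ) (ren ρ ψ)
  | ρ, ex A φ => ex (ren ρ A) (ren (upRen ρ) φ)
  | ρ, all A φ => all (ren ρ A) (ren (upRen ρ) φ)
  | ρ, eq A a b => eq (ren ρ A) (ren ρ a) (ren ρ b)
  | _, tt => tt

/-- Weakening by `k` variables. -/
def wk (k : ℕ) (e : Expr) : Expr := ren (fun n => n + k) e

/-- Weakening by `k` variables, under one binder. -/
def wk₁ (k : ℕ) (e : Expr) : Expr := ren (upRen (fun n => n + k)) e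

/-- Weakening by `k` variables, under two binders. -/
def wk₂ (k : ℕ) (e : Expr) : Expr := ren (upRen (upRen (fun n => n + k))) e

end Expr

/-- The substitution sending `var 0` to `a` and `var (n + 1)` to `σ n`. -/
def scons (a : Expr) (σ : ℕ → Expr) : ℕ → Expr
  | 0 => a
  | n + 1 => σ n

infixr:67 " ∷ " => scons

/-- The substitution that weakens by `k` variables; `shift 0` is the identity. -/
def shift (k : ℕ) : ℕ → Expr := fun n => Expr.var (n + k)

/-- A substitution going under one binder. -/
def up (σ : ℕ → Expr) : ℕ → Expr := Expr.var 0 ∷ fun n => (σ n).wk 1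

namespace Expr

/-- Simultaneous capture-avoiding substitution. -/
def subst : (ℕ → Expr) → Expr → Expr
  | σ, var n => σ n
  | _, empty => empty
  | σ, elEmpty M c => elEmpty (subst (up σ) M) (subst σ c)
  | _, unit => unit
  | _, star => star
  | σ, elUnit M t c => elUnit (subst (up σ) M) (subst σ t) (subst σ c)
  | σ, sig A B => sig (subst σ A) (subst (up σ) B)
  | σ, pair A B a b => pair (subst σ A) (subst (up σ) B) (subst σ a) (subst σ b)
  | σ, elSig A B M d m =>
      elSig (subst σ A) (subst (up σ) B) (subst (up σ) M) (subst σ d) (subst (up (up σ)) m)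
  | σ, pi A B => pi (subst σ A) (subst (up σ) B)
  | σ, lam A B b => lam (subst σ A) (subst (up σ) B) (subst (up σ) b)
  | σ, ap A B f a => ap (subst σ A) (subst (up σ) B) (subst σ f) (subst σ a)
  | σ, sum A B => sum (subst σ A) (subst σ B)
  | σ, inl A B a => inl (subst σ A) (subst σ B) (subst σ a)
  | σ, inr A B b => inr (subst σ A) (subst σ B) (subst σ b)
  | σ, elSum A B M d l r =>
      elSum (subst σ A) (subst σ B) (subst (up σ) M) (subst σ d) (subst (up σ) l) (subst (up σ) r)
  | σ, list A => list (subst σ A)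
  | σ, nil A => nil (subst σ A)
  | σ, cons A s a => cons (subst σ A) (subst σ s) (subst σ a)
  | σ, elList A M s a l =>
      elList (subst σ A) (subst (up σ) M) (subst σ s) (subst σ a) (subst (up (up (up σ))) l)
  | σ, quo A R => quo (subst σ A) (subst (up (up σ)) R)
  | σ, cls A R a => cls (subst σ A) (subst (up (up σ)) R) (subst σ a)
  | σ, elQuo A R M s l =>
      elQuo (subst σ A) (subst (up (up σ)) R) (subst (up σ) M) (subst σ s) (subst (up σ) l)
  | _, pow => pow
  | σ, code φ => code (subst σ φ)
  | _, bot => bot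
  | σ, and φ ψ => and (subst σ φ) (subst σ ψ)
  | σ, or φ ψ => or (subst σ φ) (subst σ ψ)
  | σ, imp φ ψ => imp (subst σ φ) (subst σ ψ)
  | σ, ex A φ => ex (subst σ A) (subst (up σ) φ)
  | σ, all A φ => all (subst σ A) (subst (up σ) φ)
  | σ, eq A a b => eq (subst σ A) (subst σ a) (subst σ b)
  | _, tt => tt

/-- `e[a/x]`, where `x` is the last variable of the context. -/
def inst (e a : Expr) : Expr := e.subst (a ∷ shift 0)

/-! ### Defined expressions -/

/-- `¬ φ`. -/
def neg (φ : Expr) : Expr := imp φ bot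

/-- The true proposition `⊤`. -/
def top : Expr := neg bot

/-- `φ ⇔ ψ`. -/
def iff (φ ψ : Expr) : Expr := and (imp φ ψ) (imp ψ φ)

/-- The decoding `Dc(U) := Eq(P(1), U, [⊤])` of an element of `P(1)`. -/
def dc (U : Expr) : Expr := eq pow U (code top)

end Expr

/-! ### Kinds, judgements and theories -/

/-- The four kinds of types: small propositions, propositions, sets, collections. -/
inductive Kind : Type
  | props
  | prop
  | set
  | col

/-- The inclusions between kinds. -/
inductive Kind.Incl : Kind → Kind → Prop
  | props_prop : Kind.Incl .props .prop
  | props_set : Kind.Incl .props .set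
  | prop_col : Kind.Incl .prop .col
  | set_col : Kind.Incl .set .col

/-- The resizing rules: collections are sets, propositions are small propositions. -/
inductive Kind.Resize : Kind → Kind → Prop
  | col_set : Kind.Resize .col .set
  | prop_props : Kind.Resize .prop .props

/-- Many rules come in a small version (about `set` and `props`) and a large version (about
`col` and `prop`); they are written once, with a size. -/
inductive Size : Type
  | small
  | large

/-- Sets or collections. -/
def Size.ty : Size → Kind
  | small => .set
  | large => .col

/-- Small propositions or propositions. -/
def Size.pr : Size → Kind
  | small => .props
  | large => .prop

/-- Pre-contexts; the type declared last comes first. -/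
abbrev Ctx : Type := List Expr

/-- The judgements. -/
inductive Judgement : Type
  /-- `Γ ctx` -/
  | ctx (Γ : Ctx)
  /-- `A k [Γ]`, for a kind `k` -/
  | typ (Γ : Ctx) (k : Kind) (A : Expr)
  /-- `A = B k [Γ]` -/
  | typEq (Γ : Ctx) (k : Kind) (A B : Expr)
  /-- `a ∈ A [Γ]` -/
  | tm (Γ : Ctx) (a A : Expr)
  /-- `a = b ∈ A [Γ]` -/
  | tmEq (Γ : Ctx) (a b A : Expr)

/-- The extensions of emTT considered here: with or without the law of excluded middle, with or
without the resizing rules. -/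
structure Theory : Type where
  lem : Bool
  resizing : Bool

/-! ### Derivability -/

open EmTT.Expr in
/-- Derivability in emTT and its extensions. Premises that only repeat what other premises
presuppose are added freely. -/
inductive Derives (T : Theory) : Judgement → Prop
  /- contexts and variables -/
  | ctx_nil : Derives T (.ctx [])
  | ctx_cons {Γ A} : Derives T (.ctx Γ) → Derives T (.typ Γ .col A) → Derives T (.ctx (A :: Γ))
  | var {Γ i A} : Derives T (.ctx Γ) → Γ[i]? = some A → Derives T (.tm Γ (var i) (A.wk (i + 1)))
  /- weakening and substitution: along a telescopic substitution from `Δ` to `Γ`, and along two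
  equal ones -/
  | typ_subst {Γ Δ σ k A} : Derives T (.typ Γ k A) → Derives T (.ctx Δ) →
      (∀ i C, Γ[i]? = some C → Derives T (.tm Δ (σ i) ((C.wk (i + 1)).subst σ))) →
      Derives T (.typ Δ k (A.subst σ))
  | typEq_subst {Γ Δ σ k A B} : Derives T (.typEq Γ k A B) → Derives T (.ctx Δ) →
      (∀ i C, Γ[i]? = some C → Derives T (.tm Δ (σ i) ((C.wk (i + 1)).subst σ))) →
      Derives T (.typEq Δ k (A.subst σ) (B.subst σ))
  | tm_subst {Γ Δ σ a A} : Derives T (.tm Γ a A) → Derives T (.ctx Δ) →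
      (∀ i C, Γ[i]? = some C → Derives T (.tm Δ (σ i) ((C.wk (i + 1)).subst σ))) →
      Derives T (.tm Δ (a.subst σ) (A.subst σ))
  | tmEq_subst {Γ Δ σ a b A} : Derives T (.tmEq Γ a b A) → Derives T (.ctx Δ) →
      (∀ i C, Γ[i]? = some C → Derives T (.tm Δ (σ i) ((C.wk (i + 1)).subst σ))) →
      Derives T (.tmEq Δ (a.subst σ) (b.subst σ) (A.subst σ))
  | typ_substEq {Γ Δ σ τ k A} : Derives T (.typ Γ k A) → Derives T (.ctx Δ) →
      (∀ i C, Γ[i]? = some C → Derives T (.tm Δ (σ i) ((C.wk (i + 1)).subst σ))) →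
      (∀ i C, Γ[i]? = some C → Derives T (.tm Δ (τ i) ((C.wk (i + 1)).subst τ))) →
      (∀ i C, Γ[i]? = some C → Derives T (.tmEq Δ (σ i) (τ i) ((C.wk (i + 1)).subst σ))) →
      Derives T (.typEq Δ k (A.subst σ) (A.subst τ))
  | tm_substEq {Γ Δ σ τ a A} : Derives T (.tm Γ a A) → Derives T (.ctx Δ) →
      (∀ i C, Γ[i]? = some C → Derives T (.tm Δ (σ i) ((C.wk (i + 1)).subst σ))) →
      (∀ i C, Γ[i]? = some C → Derives T (.tm Δ (τ i) ((C.wk (i + 1)).subst τ))) →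
      (∀ i C, Γ[i]? = some C → Derives T (.tmEq Δ (σ i) (τ i) ((C.wk (i + 1)).subst σ))) →
      Derives T (.tmEq Δ (a.subst σ) (a.subst τ) (A.subst σ))
  /- equality and conversion -/
  | typ_refl {Γ k A} : Derives T (.typ Γ k A) → Derives T (.typEq Γ k A A)
  | typ_symm {Γ k A B} : Derives T (.typEq Γ k A B) → Derives T (.typEq Γ k B A)
  | typ_trans {Γ k A B C} : Derives T (.typEq Γ k A B) → Derives T (.typEq Γ k B C) →
      Derives T (.typEq Γ k A C)
  | tm_refl {Γ a A} : Derives T (.tm Γ a A) → Derives T (.tmEq Γ a a A)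
  | tm_symm {Γ a b A} : Derives T (.tmEq Γ a b A) → Derives T (.tmEq Γ b a A)
  | tm_trans {Γ a b c A} : Derives T (.tmEq Γ a b A) → Derives T (.tmEq Γ b c A) →
      Derives T (.tmEq Γ a c A)
  | tm_conv {Γ k a A B} : Derives T (.tm Γ a A) → Derives T (.typEq Γ k A B) →
      Derives T (.tm Γ a B)
  | tmEq_conv {Γ k a b A B} : Derives T (.tmEq Γ a b A) → Derives T (.typEq Γ k A B) →
      Derives T (.tmEq Γ a b B)
  /- inclusions between kinds -/
  | typ_incl {Γ k l A} : Kind.Incl k l → Derives T (.typ Γ k A) → Derives T (.typ Γ l A)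
  | typEq_incl {Γ k l A B} : Kind.Incl k l → Derives T (.typEq Γ k A B) →
      Derives T (.typEq Γ l A B)
  /- the resizing rules `col-into-set` and `prop-into-prop_s` -/
  | typ_resize {Γ k l A} : T.resizing = true → Kind.Resize k l → Derives T (.typ Γ k A) →
      Derives T (.typ Γ l A)
  | typEq_resize {Γ k l A B} : T.resizing = true → Kind.Resize k l → Derives T (.typEq Γ k A B) →
      Derives T (.typEq Γ l A B)
  /- the empty set -/
  | empty_form {Γ} : Derives T (.ctx Γ) → Derives T (.typ Γ .set empty)
  | empty_elim {Γ M c} : Derives T (.typ (empty :: Γ) .col M) → Derives T (.tm Γ c empty) →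
      Derives T (.tm Γ (elEmpty M c) (M.inst c))
  | empty_elim_cong {Γ M M' c c'} : Derives T (.typEq (empty :: Γ) .col M M') →
      Derives T (.tmEq Γ c c' empty) →
      Derives T (.tmEq Γ (elEmpty M c) (elEmpty M' c') (M.inst c))
  /- the singleton set -/
  | unit_form {Γ} : Derives T (.ctx Γ) → Derives T (.typ Γ .set unit)
  | unit_intro {Γ} : Derives T (.ctx Γ) → Derives T (.tm Γ star unit)
  | unit_elim {Γ M t c} : Derives T (.typ (unit :: Γ) .col M) → Derives T (.tm Γ t unit) →
      Derives T (.tm Γ c (M.inst star)) → Derives T (.tm Γ (elUnit M t c) (M.inst t))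
  | unit_elim_cong {Γ M M' t t' c c'} : Derives T (.typEq (unit :: Γ) .col M M') →
      Derives T (.tmEq Γ t t' unit) → Derives T (.tmEq Γ c c' (M.inst star)) →
      Derives T (.tmEq Γ (elUnit M t c) (elUnit M' t' c') (M.inst t))
  | unit_beta {Γ M c} : Derives T (.typ (unit :: Γ) .col M) →
      Derives T (.tm Γ c (M.inst star)) → Derives T (.tmEq Γ (elUnit M star c) c (M.inst star))
  /- dependent sums, of sets and of collections -/
  | sig_form {Γ A B} (s : Size) : Derives T (.typ Γ s.ty A) → Derives T (.typ (A :: Γ) s.ty B) →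
      Derives T (.typ Γ s.ty (sig A B))
  | sig_cong {Γ A A' B B'} (s : Size) : Derives T (.typEq Γ s.ty A A') →
      Derives T (.typEq (A :: Γ) s.ty B B') → Derives T (.typEq Γ s.ty (sig A B) (sig A' B'))
  | sig_intro {Γ A B a b} : Derives T (.typ Γ .col A) → Derives T (.typ (A :: Γ) .col B) →
      Derives T (.tm Γ a A) → Derives T (.tm Γ b (B.inst a)) →
      Derives T (.tm Γ (pair A B a b) (sig A B))
  | sig_intro_cong {Γ A A' B B' a a' b b'} : Derives T (.typEq Γ .col A A') →
      Derives T (.typEq (A :: Γ) .col B B') → Derives T (.tmEq Γ a a' A) →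
      Derives T (.tmEq Γ b b' (B.inst a)) →
      Derives T (.tmEq Γ (pair A B a b) (pair A' B' a' b') (sig A B))
  | sig_elim {Γ A B M d m} : Derives T (.typ Γ .col A) → Derives T (.typ (A :: Γ) .col B) →
      Derives T (.typ (sig A B :: Γ) .col M) → Derives T (.tm Γ d (sig A B)) →
      Derives T (.tm (B :: A :: Γ) m
        (M.subst (pair (A.wk 2) (B.wk₁ 2) (var 1) (var 0) ∷ shift 2))) →
      Derives T (.tm Γ (elSig A B M d m) (M.inst d))
  | sig_elim_cong {Γ A A' B B' M M' d d' m m'} : Derives T (.typEq Γ .col A A') →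
      Derives T (.typEq (A :: Γ) .col B B') → Derives T (.typEq (sig A B :: Γ) .col M M') →
      Derives T (.tmEq Γ d d' (sig A B)) →
      Derives T (.tmEq (B :: A :: Γ) m m'
        (M.subst (pair (A.wk 2) (B.wk₁ 2) (var 1) (var 0) ∷ shift 2))) →
      Derives T (.tmEq Γ (elSig A B M d m) (elSig A' B' M' d' m') (M.inst d))
  | sig_beta {Γ A B M a b m} : Derives T (.typ Γ .col A) → Derives T (.typ (A :: Γ) .col B) →
      Derives T (.typ (sig A B :: Γ) .col M) → Derives T (.tm Γ a A) →
      Derives T (.tm Γ b (B.inst a)) →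
      Derives T (.tm (B :: A :: Γ) m
        (M.subst (pair (A.wk 2) (B.wk₁ 2) (var 1) (var 0) ∷ shift 2))) →
      Derives T (.tmEq Γ (elSig A B M (pair A B a b) m) (m.subst (b ∷ a ∷ shift 0))
        (M.inst (pair A B a b)))
  /- dependent products of sets, and power collections `A → P(1)` of sets -/
  | pi_form {Γ A B} : Derives T (.typ Γ .set A) → Derives T (.typ (A :: Γ) .set B) →
      Derives T (.typ Γ .set (pi A B))
  | pi_cong {Γ A A' B B'} : Derives T (.typEq Γ .set A A') →
      Derives T (.typEq (A :: Γ) .set B B') → Derives T (.typEq Γ .set (pi A B) (pi A' B'))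
  | power_form {Γ A} : Derives T (.typ Γ .set A) → Derives T (.typ Γ .col (pi A pow))
  | power_cong {Γ A A'} : Derives T (.typ Γ .set A) → Derives T (.typEq Γ .set A A') →
      Derives T (.typEq Γ .col (pi A pow) (pi A' pow))
  | pi_intro {Γ A B b} : Derives T (.typ Γ .col (pi A B)) → Derives T (.typ Γ .col A) →
      Derives T (.typ (A :: Γ) .col B) → Derives T (.tm (A :: Γ) b B) →
      Derives T (.tm Γ (lam A B b) (pi A B))
  | pi_intro_cong {Γ A A' B B' b b'} : Derives T (.typEq Γ .col (pi A B) (pi A' B')) →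
      Derives T (.typEq Γ .col A A') → Derives T (.typEq (A :: Γ) .col B B') →
      Derives T (.tmEq (A :: Γ) b b' B) →
      Derives T (.tmEq Γ (lam A B b) (lam A' B' b') (pi A B))
  | pi_elim {Γ A B f a} : Derives T (.typ Γ .col (pi A B)) → Derives T (.typ Γ .col A) →
      Derives T (.typ (A :: Γ) .col B) → Derives T (.tm Γ f (pi A B)) → Derives T (.tm Γ a A) →
      Derives T (.tm Γ (ap A B f a) (B.inst a))
  | pi_elim_cong {Γ A A' B B' f f' a a'} : Derives T (.typEq Γ .col (pi A B) (pi A' B')) →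
      Derives T (.typEq Γ .col A A') → Derives T (.typEq (A :: Γ) .col B B') →
      Derives T (.tmEq Γ f f' (pi A B)) → Derives T (.tmEq Γ a a' A) →
      Derives T (.tmEq Γ (ap A B f a) (ap A' B' f' a') (B.inst a))
  | pi_beta {Γ A B b a} : Derives T (.typ Γ .col (pi A B)) → Derives T (.typ Γ .col A) →
      Derives T (.typ (A :: Γ) .col B) → Derives T (.tm (A :: Γ) b B) → Derives T (.tm Γ a A) →
      Derives T (.tmEq Γ (ap A B (lam A B b) a) (b.inst a) (B.inst a))
  | pi_eta {Γ A B f} : Derives T (.typ Γ .col (pi A B)) → Derives T (.typ Γ .col A) →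
      Derives T (.typ (A :: Γ) .col B) → Derives T (.tm Γ f (pi A B)) →
      Derives T (.tmEq Γ (lam A B (ap (A.wk 1) (B.wk₁ 1) (f.wk 1) (var 0))) f (pi A B))
  /- disjoint sums -/
  | sum_form {Γ A B} : Derives T (.typ Γ .set A) → Derives T (.typ Γ .set B) →
      Derives T (.typ Γ .set (sum A B))
  | sum_cong {Γ A A' B B'} : Derives T (.typEq Γ .set A A') → Derives T (.typEq Γ .set B B') →
      Derives T (.typEq Γ .set (sum A B) (sum A' B'))
  | sum_inl {Γ A B a} : Derives T (.typ Γ .set A) → Derives T (.typ Γ .set B) →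
      Derives T (.tm Γ a A) → Derives T (.tm Γ (inl A B a) (sum A B))
  | sum_inl_cong {Γ A A' B B' a a'} : Derives T (.typEq Γ .set A A') →
      Derives T (.typEq Γ .set B B') → Derives T (.tmEq Γ a a' A) →
      Derives T (.tmEq Γ (inl A B a) (inl A' B' a') (sum A B))
  | sum_inr {Γ A B b} : Derives T (.typ Γ .set A) → Derives T (.typ Γ .set B) →
      Derives T (.tm Γ b B) → Derives T (.tm Γ (inr A B b) (sum A B))
  | sum_inr_cong {Γ A A' B B' b b'} : Derives T (.typEq Γ .set A A') →
      Derives T (.typEq Γ .set B B') → Derives T (.tmEq Γ b b' B) →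
      Derives T (.tmEq Γ (inr A B b) (inr A' B' b') (sum A B))
  | sum_elim {Γ A B M d l r} : Derives T (.typ Γ .set A) → Derives T (.typ Γ .set B) →
      Derives T (.typ (sum A B :: Γ) .col M) → Derives T (.tm Γ d (sum A B)) →
      Derives T (.tm (A :: Γ) l (M.subst (inl (A.wk 1) (B.wk 1) (var 0) ∷ shift 1))) →
      Derives T (.tm (B :: Γ) r (M.subst (inr (A.wk 1) (B.wk 1) (var 0) ∷ shift 1))) →
      Derives T (.tm Γ (elSum A B M d l r) (M.inst d))
  | sum_elim_cong {Γ A A' B B' M M' d d' l l' r r'} : Derives T (.typEq Γ .set A A') →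
      Derives T (.typEq Γ .set B B') → Derives T (.typEq (sum A B :: Γ) .col M M') →
      Derives T (.tmEq Γ d d' (sum A B)) →
      Derives T (.tmEq (A :: Γ) l l' (M.subst (inl (A.wk 1) (B.wk 1) (var 0) ∷ shift 1))) →
      Derives T (.tmEq (B :: Γ) r r' (M.subst (inr (A.wk 1) (B.wk 1) (var 0) ∷ shift 1))) →
      Derives T (.tmEq Γ (elSum A B M d l r) (elSum A' B' M' d' l' r') (M.inst d))
  | sum_beta_inl {Γ A B M a l r} : Derives T (.typ Γ .set A) → Derives T (.typ Γ .set B) →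
      Derives T (.typ (sum A B :: Γ) .col M) → Derives T (.tm Γ a A) →
      Derives T (.tm (A :: Γ) l (M.subst (inl (A.wk 1) (B.wk 1) (var 0) ∷ shift 1))) →
      Derives T (.tm (B :: Γ) r (M.subst (inr (A.wk 1) (B.wk 1) (var 0) ∷ shift 1))) →
      Derives T (.tmEq Γ (elSum A B M (inl A B a) l r) (l.inst a) (M.inst (inl A B a)))
  | sum_beta_inr {Γ A B M b l r} : Derives T (.typ Γ .set A) → Derives T (.typ Γ .set B) →
      Derives T (.typ (sum A B :: Γ) .col M) → Derives T (.tm Γ b B) →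
      Derives T (.tm (A :: Γ) l (M.subst (inl (A.wk 1) (B.wk 1) (var 0) ∷ shift 1))) →
      Derives T (.tm (B :: Γ) r (M.subst (inr (A.wk 1) (B.wk 1) (var 0) ∷ shift 1))) →
      Derives T (.tmEq Γ (elSum A B M (inr A B b) l r) (r.inst b) (M.inst (inr A B b)))
  /- lists -/
  | list_form {Γ A} : Derives T (.typ Γ .set A) → Derives T (.typ Γ .set (list A))
  | list_cong {Γ A A'} : Derives T (.typEq Γ .set A A') →
      Derives T (.typEq Γ .set (list A) (list A'))
  | list_nil {Γ A} : Derives T (.typ Γ .set A) → Derives T (.tm Γ (nil A) (list A))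
  | list_nil_cong {Γ A A'} : Derives T (.typEq Γ .set A A') →
      Derives T (.tmEq Γ (nil A) (nil A') (list A))
  | list_cons {Γ A s a} : Derives T (.typ Γ .set A) → Derives T (.tm Γ s (list A)) →
      Derives T (.tm Γ a A) → Derives T (.tm Γ (cons A s a) (list A))
  | list_cons_cong {Γ A A' s s' a a'} : Derives T (.typEq Γ .set A A') →
      Derives T (.tmEq Γ s s' (list A)) → Derives T (.tmEq Γ a a' A) →
      Derives T (.tmEq Γ (cons A s a) (cons A' s' a') (list A))
  | list_elim {Γ A M s a l} : Derives T (.typ Γ .set A) → Derives T (.typ (list A :: Γ) .col M) →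
      Derives T (.tm Γ s (list A)) → Derives T (.tm Γ a (M.inst (nil A))) →
      Derives T (.tm (M.subst (var 1 ∷ shift 2) :: A.wk 1 :: list A :: Γ) l
        (M.subst (cons (A.wk 3) (var 2) (var 1) ∷ shift 3))) →
      Derives T (.tm Γ (elList A M s a l) (M.inst s))
  | list_elim_cong {Γ A A' M M' s s' a a' l l'} : Derives T (.typEq Γ .set A A') →
      Derives T (.typEq (list A :: Γ) .col M M') → Derives T (.tmEq Γ s s' (list A)) →
      Derives T (.tmEq Γ a a' (M.inst (nil A))) →
      Derives T (.tmEq (M.subst (var 1 ∷ shift 2) :: A.wk 1 :: list A :: Γ) l l'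
        (M.subst (cons (A.wk 3) (var 2) (var 1) ∷ shift 3))) →
      Derives T (.tmEq Γ (elList A M s a l) (elList A' M' s' a' l') (M.inst s))
  | list_beta_nil {Γ A M a l} : Derives T (.typ Γ .set A) →
      Derives T (.typ (list A :: Γ) .col M) → Derives T (.tm Γ a (M.inst (nil A))) →
      Derives T (.tm (M.subst (var 1 ∷ shift 2) :: A.wk 1 :: list A :: Γ) l
        (M.subst (cons (A.wk 3) (var 2) (var 1) ∷ shift 3))) →
      Derives T (.tmEq Γ (elList A M (nil A) a l) a (M.inst (nil A)))
  | list_beta_cons {Γ A M s c a l} : Derives T (.typ Γ .set A) →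
      Derives T (.typ (list A :: Γ) .col M) → Derives T (.tm Γ s (list A)) →
      Derives T (.tm Γ c A) → Derives T (.tm Γ a (M.inst (nil A))) →
      Derives T (.tm (M.subst (var 1 ∷ shift 2) :: A.wk 1 :: list A :: Γ) l
        (M.subst (cons (A.wk 3) (var 2) (var 1) ∷ shift 3))) →
      Derives T (.tmEq Γ (elList A M (cons A s c) a l)
        (l.subst (elList A M s a l ∷ c ∷ s ∷ shift 0)) (M.inst (cons A s c)))
  /- quotients of a set by a small equivalence relation, which are effective -/
  | quo_form {Γ A R} : Derives T (.typ Γ .set A) → Derives T (.typ (A.wk 1 :: A :: Γ) .props R) →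
      Derives T (.tm (A :: Γ) tt (R.subst (var 0 ∷ var 0 ∷ shift 1))) →
      Derives T (.tm (R :: A.wk 1 :: A :: Γ) tt (R.subst (var 2 ∷ var 1 ∷ shift 3))) →
      Derives T (.tm (R.subst (var 1 ∷ var 2 ∷ shift 4) :: R.subst (var 1 ∷ var 2 ∷ shift 3) ::
        A.wk 2 :: A.wk 1 :: A :: Γ) tt (R.subst (var 2 ∷ var 4 ∷ shift 5))) →
      Derives T (.typ Γ .set (quo A R))
  | quo_cong {Γ A A' R R'} : Derives T (.typ Γ .set (quo A R)) → Derives T (.typEq Γ .set A A') →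
      Derives T (.typEq (A.wk 1 :: A :: Γ) .props R R') →
      Derives T (.typEq Γ .set (quo A R) (quo A' R'))
  | quo_intro {Γ A R a} : Derives T (.typ Γ .set (quo A R)) → Derives T (.tm Γ a A) →
      Derives T (.tm Γ (cls A R a) (quo A R))
  | quo_intro_cong {Γ A A' R R' a a'} : Derives T (.typ Γ .set (quo A R)) →
      Derives T (.typEq Γ .set A A') → Derives T (.typEq (A.wk 1 :: A :: Γ) .props R R') →
      Derives T (.tmEq Γ a a' A) → Derives T (.tmEq Γ (cls A R a) (cls A' R' a') (quo A R))
  | quo_eq {Γ A R a b} : Derives T (.typ Γ .set (quo A R)) → Derives T (.tm Γ a A) →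
      Derives T (.tm Γ b A) → Derives T (.tm Γ tt (R.subst (b ∷ a ∷ shift 0))) →
      Derives T (.tmEq Γ (cls A R a) (cls A R b) (quo A R))
  | quo_eff {Γ A R a b} : Derives T (.typ Γ .set (quo A R)) → Derives T (.tm Γ a A) →
      Derives T (.tm Γ b A) → Derives T (.tmEq Γ (cls A R a) (cls A R b) (quo A R)) →
      Derives T (.tm Γ tt (R.subst (b ∷ a ∷ shift 0)))
  | quo_elim {Γ A R M s l} : Derives T (.typ Γ .set (quo A R)) →
      Derives T (.typ (quo A R :: Γ) .col M) → Derives T (.tm Γ s (quo A R)) →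
      Derives T (.tm (A :: Γ) l (M.subst (cls (A.wk 1) (R.wk₂ 1) (var 0) ∷ shift 1))) →
      Derives T (.tmEq (R :: A.wk 1 :: A :: Γ) (l.subst (var 2 ∷ shift 3))
        (l.subst (var 1 ∷ shift 3)) (M.subst (cls (A.wk 3) (R.wk₂ 3) (var 2) ∷ shift 3))) →
      Derives T (.tm Γ (elQuo A R M s l) (M.inst s))
  | quo_elim_cong {Γ A A' R R' M M' s s' l l'} : Derives T (.typ Γ .set (quo A R)) →
      Derives T (.typEq Γ .set A A') → Derives T (.typEq (A.wk 1 :: A :: Γ) .props R R') →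
      Derives T (.typEq (quo A R :: Γ) .col M M') → Derives T (.tmEq Γ s s' (quo A R)) →
      Derives T (.tmEq (A :: Γ) l l' (M.subst (cls (A.wk 1) (R.wk₂ 1) (var 0) ∷ shift 1))) →
      Derives T (.tmEq (R :: A.wk 1 :: A :: Γ) (l.subst (var 2 ∷ shift 3))
        (l.subst (var 1 ∷ shift 3)) (M.subst (cls (A.wk 3) (R.wk₂ 3) (var 2) ∷ shift 3))) →
      Derives T (.tmEq Γ (elQuo A R M s l) (elQuo A' R' M' s' l') (M.inst s))
  | quo_beta {Γ A R M a l} : Derives T (.typ Γ .set (quo A R)) →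
      Derives T (.typ (quo A R :: Γ) .col M) → Derives T (.tm Γ a A) →
      Derives T (.tm (A :: Γ) l (M.subst (cls (A.wk 1) (R.wk₂ 1) (var 0) ∷ shift 1))) →
      Derives T (.tmEq (R :: A.wk 1 :: A :: Γ) (l.subst (var 2 ∷ shift 3))
        (l.subst (var 1 ∷ shift 3)) (M.subst (cls (A.wk 3) (R.wk₂ 3) (var 2) ∷ shift 3))) →
      Derives T (.tmEq Γ (elQuo A R M (cls A R a) l) (l.inst a) (M.inst (cls A R a)))
  /- the power collection of the singleton: small propositions up to equiprovability -/
  | pow_form {Γ} : Derives T (.ctx Γ) → Derives T (.typ Γ .col pow)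
  | pow_intro {Γ φ} : Derives T (.typ Γ .props φ) → Derives T (.tm Γ (code φ) pow)
  | pow_intro_cong {Γ φ ψ} : Derives T (.typ Γ .props φ) → Derives T (.typ Γ .props ψ) →
      Derives T (.typEq Γ .props φ ψ) → Derives T (.tmEq Γ (code φ) (code ψ) pow)
  | pow_eq {Γ φ ψ} : Derives T (.typ Γ .props φ) → Derives T (.typ Γ .props ψ) →
      Derives T (.tm Γ tt (iff φ ψ)) → Derives T (.tmEq Γ (code φ) (code ψ) pow)
  | pow_eff {Γ φ ψ} : Derives T (.typ Γ .props φ) → Derives T (.typ Γ .props ψ) →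
      Derives T (.tmEq Γ (code φ) (code ψ) pow) → Derives T (.tm Γ tt (iff φ ψ))
  | pow_eq_form {Γ U V} : Derives T (.tm Γ U pow) → Derives T (.tm Γ V pow) →
      Derives T (.typ Γ .props (eq pow U V))
  | pow_eq_cong {Γ U U' V V'} : Derives T (.tmEq Γ U U' pow) → Derives T (.tmEq Γ V V' pow) →
      Derives T (.typEq Γ .props (eq pow U V) (eq pow U' V'))
  | pow_eta {Γ U} : Derives T (.tm Γ U pow) → Derives T (.tmEq Γ (code (dc U)) U pow)
  /- propositions are proof-irrelevant and have the canonical proof-term `true` -/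
  | prop_mono {Γ φ p q} : Derives T (.typ Γ .prop φ) → Derives T (.tm Γ p φ) →
      Derives T (.tm Γ q φ) → Derives T (.tmEq Γ p q φ)
  | prop_true {Γ φ p} : Derives T (.typ Γ .prop φ) → Derives T (.tm Γ p φ) →
      Derives T (.tm Γ tt φ)
  /- falsum -/
  | bot_form {Γ} : Derives T (.ctx Γ) → Derives T (.typ Γ .props bot)
  | bot_elim {Γ φ} : Derives T (.typ Γ .prop φ) → Derives T (.tm Γ tt bot) →
      Derives T (.tm Γ tt φ)
  /- conjunction -/
  | and_form {Γ φ ψ} (s : Size) : Derives T (.typ Γ s.pr φ) → Derives T (.typ Γ s.pr ψ) →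
      Derives T (.typ Γ s.pr (and φ ψ))
  | and_cong {Γ φ φ' ψ ψ'} (s : Size) : Derives T (.typEq Γ s.pr φ φ') →
      Derives T (.typEq Γ s.pr ψ ψ') → Derives T (.typEq Γ s.pr (and φ ψ) (and φ' ψ'))
  | and_intro {Γ φ ψ} : Derives T (.typ Γ .prop φ) → Derives T (.typ Γ .prop ψ) →
      Derives T (.tm Γ tt φ) → Derives T (.tm Γ tt ψ) → Derives T (.tm Γ tt (and φ ψ))
  | and_left {Γ φ ψ} : Derives T (.typ Γ .prop φ) → Derives T (.typ Γ .prop ψ) →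
      Derives T (.tm Γ tt (and φ ψ)) → Derives T (.tm Γ tt φ)
  | and_right {Γ φ ψ} : Derives T (.typ Γ .prop φ) → Derives T (.typ Γ .prop ψ) →
      Derives T (.tm Γ tt (and φ ψ)) → Derives T (.tm Γ tt ψ)
  /- disjunction -/
  | or_form {Γ φ ψ} (s : Size) : Derives T (.typ Γ s.pr φ) → Derives T (.typ Γ s.pr ψ) →
      Derives T (.typ Γ s.pr (or φ ψ))
  | or_cong {Γ φ φ' ψ ψ'} (s : Size) : Derives T (.typEq Γ s.pr φ φ') →
      Derives T (.typEq Γ s.pr ψ ψ') → Derives T (.typEq Γ s.pr (or φ ψ) (or φ' ψ'))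
  | or_left {Γ φ ψ} : Derives T (.typ Γ .prop φ) → Derives T (.typ Γ .prop ψ) →
      Derives T (.tm Γ tt φ) → Derives T (.tm Γ tt (or φ ψ))
  | or_right {Γ φ ψ} : Derives T (.typ Γ .prop φ) → Derives T (.typ Γ .prop ψ) →
      Derives T (.tm Γ tt ψ) → Derives T (.tm Γ tt (or φ ψ))
  | or_elim {Γ φ ψ χ} : Derives T (.typ Γ .prop φ) → Derives T (.typ Γ .prop ψ) →
      Derives T (.typ Γ .prop χ) → Derives T (.tm Γ tt (or φ ψ)) →
      Derives T (.tm (φ :: Γ) tt (χ.wk 1)) → Derives T (.tm (ψ :: Γ) tt (χ.wk 1)) →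
      Derives T (.tm Γ tt χ)
  /- implication -/
  | imp_form {Γ φ ψ} (s : Size) : Derives T (.typ Γ s.pr φ) → Derives T (.typ Γ s.pr ψ) →
      Derives T (.typ Γ s.pr (imp φ ψ))
  | imp_cong {Γ φ φ' ψ ψ'} (s : Size) : Derives T (.typEq Γ s.pr φ φ') →
      Derives T (.typEq Γ s.pr ψ ψ') → Derives T (.typEq Γ s.pr (imp φ ψ) (imp φ' ψ'))
  | imp_intro {Γ φ ψ} : Derives T (.typ Γ .prop φ) → Derives T (.typ Γ .prop ψ) →
      Derives T (.tm (φ :: Γ) tt (ψ.wk 1)) → Derives T (.tm Γ tt (imp φ ψ))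
  | imp_elim {Γ φ ψ} : Derives T (.typ Γ .prop φ) → Derives T (.typ Γ .prop ψ) →
      Derives T (.tm Γ tt (imp φ ψ)) → Derives T (.tm Γ tt φ) → Derives T (.tm Γ tt ψ)
  /- existential quantification -/
  | ex_form {Γ A φ} (s : Size) : Derives T (.typ Γ s.ty A) → Derives T (.typ (A :: Γ) s.pr φ) →
      Derives T (.typ Γ s.pr (ex A φ))
  | ex_cong {Γ A A' φ φ'} (s : Size) : Derives T (.typEq Γ s.ty A A') →
      Derives T (.typEq (A :: Γ) s.pr φ φ') → Derives T (.typEq Γ s.pr (ex A φ) (ex A' φ'))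
  | ex_intro {Γ A φ a} : Derives T (.typ Γ .col A) → Derives T (.typ (A :: Γ) .prop φ) →
      Derives T (.tm Γ a A) → Derives T (.tm Γ tt (φ.inst a)) → Derives T (.tm Γ tt (ex A φ))
  | ex_elim {Γ A φ χ} : Derives T (.typ Γ .col A) → Derives T (.typ (A :: Γ) .prop φ) →
      Derives T (.typ Γ .prop χ) → Derives T (.tm Γ tt (ex A φ)) →
      Derives T (.tm (φ :: A :: Γ) tt (χ.wk 2)) → Derives T (.tm Γ tt χ)
  /- universal quantification -/
  | all_form {Γ A φ} (s : Size) : Derives T (.typ Γ s.ty A) → Derives T (.typ (A :: Γ) s.pr φ) →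
      Derives T (.typ Γ s.pr (all A φ))
  | all_cong {Γ A A' φ φ'} (s : Size) : Derives T (.typEq Γ s.ty A A') →
      Derives T (.typEq (A :: Γ) s.pr φ φ') → Derives T (.typEq Γ s.pr (all A φ) (all A' φ'))
  | all_intro {Γ A φ} : Derives T (.typ Γ .col A) → Derives T (.typ (A :: Γ) .prop φ) →
      Derives T (.tm (A :: Γ) tt φ) → Derives T (.tm Γ tt (all A φ))
  | all_elim {Γ A φ a} : Derives T (.typ Γ .col A) → Derives T (.typ (A :: Γ) .prop φ) →
      Derives T (.tm Γ tt (all A φ)) → Derives T (.tm Γ a A) → Derives T (.tm Γ tt (φ.inst a))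
  /- propositional equality, with reflection -/
  | eq_form {Γ A a b} (s : Size) : Derives T (.typ Γ s.ty A) → Derives T (.tm Γ a A) →
      Derives T (.tm Γ b A) → Derives T (.typ Γ s.pr (eq A a b))
  | eq_cong {Γ A A' a a' b b'} (s : Size) : Derives T (.typEq Γ s.ty A A') →
      Derives T (.tmEq Γ a a' A) → Derives T (.tmEq Γ b b' A) →
      Derives T (.typEq Γ s.pr (eq A a b) (eq A' a' b'))
  | eq_intro {Γ A a} : Derives T (.typ Γ .col A) → Derives T (.tm Γ a A) →
      Derives T (.tm Γ tt (eq A a a))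
  | eq_elim {Γ A a b} : Derives T (.typ Γ .col A) → Derives T (.tm Γ a A) →
      Derives T (.tm Γ b A) → Derives T (.tm Γ tt (eq A a b)) → Derives T (.tmEq Γ a b A)
  /- the law of excluded middle -/
  | lem {Γ φ} : T.lem = true → Derives T (.typ Γ .prop φ) → Derives T (.tm Γ tt (or φ (neg φ)))

/-! ### The theories, and consistency -/

/-- emTT. -/
def emTT : Theory := ⟨false, false⟩

/-- emTT with the law of excluded middle. -/
def emTTc : Theory := ⟨true, false⟩

/-- emTT with the resizing rules. -/
def emTTImp : Theory := ⟨false, true⟩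

/-- emTT with the resizing rules and the law of excluded middle. -/
def emTTcImp : Theory := ⟨true, true⟩

/-- Consistency: the judgement `true ∈ ⊥ [ ]` is not derivable. -/
def Consistent (T : Theory) : Prop := ¬ Derives T (.tm [] Expr.tt Expr.bot)

/-- Equiconsistency: each theory is consistent if the other one is. -/
def Equiconsistent (T S : Theory) : Prop := Consistent T ↔ Consistent S

/-! ### The double-negation translation -/

namespace Expr

/-- `¬¬ Dc(x) ⇒ Dc(x)`, where `x` is `var 0`. -/
def stablePow : Expr := imp (neg (neg (dc (var 0)))) (dc (var 0))

/-- The double-negation translation of expressions: disjunctions and existential quantifications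
are double-negated, `P(1)` is cut down to the stable propositions, and all other constructors
are left unaltered. -/
def dn : Expr → Expr
  | var n => var n
  | empty => empty
  | elEmpty M c => elEmpty (dn M) (dn c)
  | unit => unit
  | star => star
  | elUnit M t c => elUnit (dn M) (dn t) (dn c)
  | sig A B => sig (dn A) (dn B)
  | pair A B a b => pair (dn A) (dn B) (dn a) (dn b)
  | elSig A B M d m => elSig (dn A) (dn B) (dn M) (dn d) (dn m)
  | pi A B => pi (dn A) (dn B)
  | lam A B b => lam (dn A) (dn B) (dn b)
  | ap A B f a => ap (dn A) (dn B) (dn f) (dn a)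
  | sum A B => sum (dn A) (dn B)
  | inl A B a => inl (dn A) (dn B) (dn a)
  | inr A B b => inr (dn A) (dn B) (dn b)
  | elSum A B M d l r => elSum (dn A) (dn B) (dn M) (dn d) (dn l) (dn r)
  | list A => list (dn A)
  | nil A => nil (dn A)
  | cons A s a => cons (dn A) (dn s) (dn a)
  | elList A M s a l => elList (dn A) (dn M) (dn s) (dn a) (dn l)
  | quo A R => quo (dn A) (dn R)
  | cls A R a => cls (dn A) (dn R) (dn a)
  | elQuo A R M s l => elQuo (dn A) (dn R) (dn M) (dn s) (dn l)
  | pow => sig pow stablePow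
  | code φ => pair pow stablePow (code (dn φ)) tt
  | bot => bot
  | and φ ψ => and (dn φ) (dn ψ)
  | or φ ψ => neg (neg (or (dn φ) (dn ψ)))
  | imp φ ψ => imp (dn φ) (dn ψ)
  | ex A φ => neg (neg (ex (dn A) (dn φ)))
  | all A φ => all (dn A) (dn φ)
  | eq A a b => eq (dn A) (dn a) (dn b)
  | tt => tt

end Expr

/-- The translation of contexts. -/
def Ctx.dn (Γ : Ctx) : Ctx := List.map Expr.dn Γ

/-- The translation of judgements. -/
def Judgement.dn : Judgement → Judgement
  | .ctx Γ => .ctx (Ctx.dn Γ)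
  | .typ Γ k A => .typ (Ctx.dn Γ) k A.dn
  | .typEq Γ k A B => .typEq (Ctx.dn Γ) k A.dn B.dn
  | .tm Γ a A => .tm (Ctx.dn Γ) a.dn A.dn
  | .tmEq Γ a b A => .tmEq (Ctx.dn Γ) a.dn b.dn A.dn

/-- The proposition `φ` is stable in the context `Γ`. -/
def Stable (T : Theory) (Γ : Ctx) (φ : Expr) : Prop :=
  Derives T (.tm Γ Expr.tt (Expr.imp (Expr.neg (Expr.neg φ)) φ))

/-- The collection `A` has stable equality in the context `Γ`. -/
def StableEq (T : Theory) (Γ : Ctx) (A : Expr) : Prop :=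
  Stable T (A.wk 1 :: A :: Γ) (Expr.eq (A.wk 2) (Expr.var 1) (Expr.var 0))

end EmTT

/-! This is a Gödel–Gentzen argument. In the target theory, ¬¬(φ ∨ ¬φ) is provable, and the
remaining classical rules survive as long as every translated proposition is stable, since a
conclusion can then be proved from a double-negated disjunction or existential. In a type theory
with `Eq` this requires more: an equality proposition is stable only if its type has stable
equality. Hence one induction on derivations (`Derives.interp`) proves three things together,
recorded in `Interp`: the translated judgement is derivable, translated types have stable equality,
and translated propositions are stable.

Stability is formulated externally, as closure of derivability under all well-typed substitutions
(`StableProp`, `StableType`). It is then preserved by the substitution rules and can be used in any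
extension of the context. Equality reflection allows the conclusion for types to be a judgemental
equality.

Every type constructor preserves stable equality. Products use extensionality (`dnEq_pi`) and
dependent sums use surjective pairing (`dnEq_sig`). Disjoint sums and lists use injectivity and
disjointness of the constructors, the latter obtained by eliminating towards P(1), where [⊤] = [⊥]
is absurd. Quotients use effectiveness together with stability of the relation (`stab_cls_cls`).

P(1) is the only obstacle, because stable equality there would amount to double-negation elimination
for small propositions. Its translation keeps only the elements whose decoding is stable, and these
are determined by that decoding (`stableType_stablePowCol`). The new collection is a dependent sum:
neither the smallness of its equality nor the formation of functions into it comes from the rules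
for P(1). The resizing rules supply both.

Since ⊥ and `true` translate to themselves, the interpretation gives one half of equiconsistency;
inclusion of theories gives the other. -/

namespace EmTT

open EmTT.Expr

/-! ### The substitution calculus -/

/-- Composition of substitutions: first `σ`, then `τ`. -/
def comp (σ τ : ℕ → Expr) : ℕ → Expr := fun n => (σ n).subst τ

@[simp] theorem comp_apply (σ τ : ℕ → Expr) (n : ℕ) : comp σ τ n = (σ n).subst τ := rfl

@[simp] theorem scons_zero (a : Expr) (σ : ℕ → Expr) : (a ∷ σ) 0 = a := rfl

@[simp] theorem scons_succ (a : Expr) (σ : ℕ → Expr) (n : ℕ) : (a ∷ σ) (n + 1) = σ n := rfl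

@[simp] theorem scons_one (a : Expr) (σ : ℕ → Expr) : (a ∷ σ) 1 = σ 0 := rfl

@[simp] theorem scons_two (a : Expr) (σ : ℕ → Expr) : (a ∷ σ) 2 = σ 1 := rfl

@[simp] theorem shift_apply (k n : ℕ) : shift k n = var (n + k) := rfl

theorem up_var (ρ : ℕ → ℕ) : up (fun n => var (ρ n)) = fun n => var (upRen ρ n) := by
  funext n; cases n <;> rfl

/-- Makes weakening a special case of substitution, so that one calculus handles both. -/
theorem ren_eq_subst (ρ : ℕ → ℕ) (e : Expr) : e.ren ρ = e.subst fun n => var (ρ n) := by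
  induction e generalizing ρ <;> simp_all [ren, subst, up_var]

/-- A substitution is weakened when it passes a binder, so composition is first proved with a
renaming on one side, here and in `ren_subst`. These two cases give `up_comp`, and with it the
general law. -/
theorem subst_ren (ρ : ℕ → ℕ) (σ : ℕ → Expr) (e : Expr) :
    (e.ren ρ).subst σ = e.subst fun n => σ (ρ n) := by
  have key (ρ : ℕ → ℕ) (σ : ℕ → Expr) :
      (fun n => up σ (upRen ρ n)) = up fun n => σ (ρ n) := by
    funext n; cases n <;> rfl
  induction e generalizing ρ σ <;> simp_all [ren, subst]

theorem upRen_succ (ρ : ℕ → ℕ) (e : Expr) : (e.wk 1).ren (upRen ρ) = (e.ren ρ).wk 1 := by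
  simp only [wk]
  rw [ren_eq_subst, subst_ren, ren_eq_subst _ (e.ren ρ), subst_ren]
  rfl

theorem ren_subst (ρ : ℕ → ℕ) (σ : ℕ → Expr) (e : Expr) :
    (e.subst σ).ren ρ = e.subst fun n => (σ n).ren ρ := by
  have key (ρ : ℕ → ℕ) (σ : ℕ → Expr) :
      (fun n => (up σ n).ren (upRen ρ)) = up fun n => (σ n).ren ρ := by
    funext n
    cases n with
    | zero => rfl
    | succ n => exact upRen_succ ρ (σ n)
  induction e generalizing ρ σ <;> simp_all [ren, subst]

theorem up_comp (σ τ : ℕ → Expr) : comp (up σ) (up τ) = up (comp σ τ) := by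
  funext n
  cases n with
  | zero => rfl
  | succ n =>
    change ((σ n).wk 1).subst (up τ) = ((σ n).subst τ).wk 1
    simp only [wk]
    rw [subst_ren, ren_subst]
    rfl

@[simp] theorem subst_subst (σ τ : ℕ → Expr) (e : Expr) :
    (e.subst σ).subst τ = e.subst (comp σ τ) := by
  induction e generalizing σ τ <;> simp_all [subst, up_comp]

-- Together with the simp lemmas that follow, this brings weakenings and lifted substitutions to a
-- normal form built from `∷`, `comp` and `shift`. Matching a substituted type with the type a rule
-- expects then becomes a call to `simp`.
@[simp] theorem wk_eq_subst (k : ℕ) (e : Expr) : e.wk k = e.subst (shift k) := ren_eq_subst _ e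

@[simp] theorem up_eq (σ : ℕ → Expr) : up σ = var 0 ∷ comp σ (shift 1) := by
  funext n
  cases n with
  | zero => rfl
  | succ n => exact wk_eq_subst 1 (σ n)

@[simp] theorem wk₁_eq_subst (k : ℕ) (e : Expr) : e.wk₁ k = e.subst (up (shift k)) := by
  rw [wk₁, ren_eq_subst, ← up_var]; rfl

@[simp] theorem wk₂_eq_subst (k : ℕ) (e : Expr) : e.wk₂ k = e.subst (up (up (shift k))) := by
  rw [wk₂, ren_eq_subst, ← up_var, ← up_var]; rfl

attribute [simp] subst inst

@[simp] theorem comp_assoc (σ τ υ : ℕ → Expr) : comp (comp σ τ) υ = comp σ (comp τ υ) := by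
  funext n; simp

@[simp] theorem scons_comp (a : Expr) (σ τ : ℕ → Expr) :
    comp (a ∷ σ) τ = a.subst τ ∷ comp σ τ := by
  funext n; cases n <;> rfl

@[simp] theorem var_scons_shift (k : ℕ) : (var k ∷ shift (k + 1)) = shift k := by
  funext n
  cases n with
  | zero => simp
  | succ n => simp; omega

@[simp] theorem var_zero_scons_shift : (var 0 ∷ shift 1) = shift 0 := var_scons_shift 0

@[simp] theorem var_one_scons_shift : (var 1 ∷ shift 2) = shift 1 := var_scons_shift 1

@[simp] theorem var_two_scons_shift : (var 2 ∷ shift 3) = shift 2 := var_scons_shift 2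

@[simp] theorem subst_shift_zero (e : Expr) : e.subst (shift 0) = e := by
  have key : up (shift 0) = shift 0 := by rw [up_eq]; exact var_scons_shift 0
  -- `up_eq` is withheld so that `key` can rewrite the lifted identity.
  induction e <;> simp_all [-up_eq]

@[simp] theorem comp_shift_zero (σ : ℕ → Expr) : comp σ (shift 0) = σ := by
  funext n; simp

@[simp] theorem shift_zero_comp (σ : ℕ → Expr) : comp (shift 0) σ = σ := by
  funext n; simp

theorem shift_succ_comp (k : ℕ) (a : Expr) (σ : ℕ → Expr) :
    comp (shift (k + 1)) (a ∷ σ) = comp (shift k) σ := by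
  funext n
  change (a ∷ σ) (n + k + 1) = σ (n + k)
  rfl

@[simp] theorem shift_one_comp (a : Expr) (σ : ℕ → Expr) : comp (shift 1) (a ∷ σ) = σ := by
  rw [← shift_zero_comp σ]; exact shift_succ_comp 0 a _

@[simp] theorem shift_two_comp (a : Expr) (σ : ℕ → Expr) :
    comp (shift 2) (a ∷ σ) = comp (shift 1) σ := shift_succ_comp 1 a σ

@[simp] theorem shift_three_comp (a : Expr) (σ : ℕ → Expr) :
    comp (shift 3) (a ∷ σ) = comp (shift 2) σ := shift_succ_comp 2 a σ

@[simp] theorem shift_comp_shift (k l : ℕ) : comp (shift k) (shift l) = shift (k + l) := by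
  funext n; simp [Nat.add_assoc]

@[simp] theorem shift_comp_shift_comp (k l : ℕ) (σ : ℕ → Expr) :
    comp (shift k) (comp (shift l) σ) = comp (shift (k + l)) σ := by
  rw [← comp_assoc, shift_comp_shift]

@[simp] theorem subst_neg (σ : ℕ → Expr) (φ : Expr) : (neg φ).subst σ = neg (φ.subst σ) := rfl

@[simp] theorem subst_top (σ : ℕ → Expr) : top.subst σ = top := rfl

@[simp] theorem subst_dc (σ : ℕ → Expr) (U : Expr) : (dc U).subst σ = dc (U.subst σ) := rfl

-- The bound variable is the only free variable of `stablePow`, so the translated power collection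
-- is closed.
@[simp] theorem subst_stablePow (σ : ℕ → Expr) :
    stablePow.subst (var 0 ∷ σ) = stablePow := rfl

/-! ### The translation commutes with substitution -/

/-- The double-negation translation of substitutions. -/
def dnSubst (σ : ℕ → Expr) : ℕ → Expr := fun n => (σ n).dn

@[simp] theorem dnSubst_apply (σ : ℕ → Expr) (n : ℕ) : dnSubst σ n = (σ n).dn := rfl

@[simp] theorem dnSubst_scons (a : Expr) (σ : ℕ → Expr) :
    dnSubst (a ∷ σ) = a.dn ∷ dnSubst σ := by
  funext n; cases n <;> rfl

@[simp] theorem dnSubst_shift (k : ℕ) : dnSubst (shift k) = shift k := rfl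

theorem dn_ren (ρ : ℕ → ℕ) (e : Expr) : (e.ren ρ).dn = e.dn.ren ρ := by
  induction e generalizing ρ <;> simp_all [ren, dn, neg, stablePow, dc, top, upRen]

theorem dnSubst_up (σ : ℕ → Expr) : dnSubst (up σ) = up (dnSubst σ) := by
  funext n
  cases n with
  | zero => rfl
  | succ n => exact dn_ren _ (σ n)

/-- The translation adds only negations and closed material, so nothing is captured. An instance of
a rule is therefore translated with its substitutions intact. -/
theorem dn_subst (σ : ℕ → Expr) (e : Expr) : (e.subst σ).dn = e.dn.subst (dnSubst σ) := by
  induction e generalizing σ <;>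
    simp_all [-up_eq, dnSubst_up, dn, neg, stablePow, dc, top]
  -- What remains is the value of a lifted substitution at the bound variable of `stablePow`.
  all_goals simp [up]

theorem dn_wk (k : ℕ) (e : Expr) : (e.wk k).dn = e.dn.wk k := dn_ren _ e

theorem dn_wk₁ (k : ℕ) (e : Expr) : (e.wk₁ k).dn = e.dn.wk₁ k := dn_ren _ e

theorem dn_wk₂ (k : ℕ) (e : Expr) : (e.wk₂ k).dn = e.dn.wk₂ k := dn_ren _ e

theorem dn_inst (e a : Expr) : (e.inst a).dn = e.dn.inst a.dn := by
  rw [inst, dn_subst, dnSubst_scons]; rfl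

/-! ### Monotonicity and presupposed contexts -/

/-- A theory with more principles derives more judgements. -/
theorem Derives.mono {T S : Theory} {J : Judgement} (hl : T.lem = true → S.lem = true)
    (hr : T.resizing = true → S.resizing = true) (h : Derives T J) : Derives S J := by
  induction h with
  | ctx_nil => exact .ctx_nil
  | ctx_cons _ _ i0 i1 => exact .ctx_cons i0 i1
  | var _ h1 i0 => exact .var i0 h1
  | typ_subst _ _ _ i0 i1 i2 => exact .typ_subst i0 i1 i2
  | typEq_subst _ _ _ i0 i1 i2 => exact .typEq_subst i0 i1 i2
  | tm_subst _ _ _ i0 i1 i2 => exact .tm_subst i0 i1 i2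
  | tmEq_subst _ _ _ i0 i1 i2 => exact .tmEq_subst i0 i1 i2
  | typ_substEq _ _ _ _ _ i0 i1 i2 i3 i4 => exact .typ_substEq i0 i1 i2 i3 i4
  | tm_substEq _ _ _ _ _ i0 i1 i2 i3 i4 => exact .tm_substEq i0 i1 i2 i3 i4
  | typ_refl _ i0 => exact .typ_refl i0
  | typ_symm _ i0 => exact .typ_symm i0
  | typ_trans _ _ i0 i1 => exact .typ_trans i0 i1
  | tm_refl _ i0 => exact .tm_refl i0
  | tm_symm _ i0 => exact .tm_symm i0
  | tm_trans _ _ i0 i1 => exact .tm_trans i0 i1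
  | tm_conv _ _ i0 i1 => exact .tm_conv i0 i1
  | tmEq_conv _ _ i0 i1 => exact .tmEq_conv i0 i1
  | typ_incl h0 _ i1 => exact .typ_incl h0 i1
  | typEq_incl h0 _ i1 => exact .typEq_incl h0 i1
  | typ_resize h0 h1 _ i2 => exact .typ_resize (hr h0) h1 i2
  | typEq_resize h0 h1 _ i2 => exact .typEq_resize (hr h0) h1 i2
  | empty_form _ i0 => exact .empty_form i0
  | empty_elim _ _ i0 i1 => exact .empty_elim i0 i1
  | empty_elim_cong _ _ i0 i1 => exact .empty_elim_cong i0 i1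
  | unit_form _ i0 => exact .unit_form i0
  | unit_intro _ i0 => exact .unit_intro i0
  | unit_elim _ _ _ i0 i1 i2 => exact .unit_elim i0 i1 i2
  | unit_elim_cong _ _ _ i0 i1 i2 => exact .unit_elim_cong i0 i1 i2
  | unit_beta _ _ i0 i1 => exact .unit_beta i0 i1
  | sig_form s _ _ i0 i1 => exact .sig_form s i0 i1
  | sig_cong s _ _ i0 i1 => exact .sig_cong s i0 i1
  | sig_intro _ _ _ _ i0 i1 i2 i3 => exact .sig_intro i0 i1 i2 i3
  | sig_intro_cong _ _ _ _ i0 i1 i2 i3 => exact .sig_intro_cong i0 i1 i2 i3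
  | sig_elim _ _ _ _ _ i0 i1 i2 i3 i4 => exact .sig_elim i0 i1 i2 i3 i4
  | sig_elim_cong _ _ _ _ _ i0 i1 i2 i3 i4 => exact .sig_elim_cong i0 i1 i2 i3 i4
  | sig_beta _ _ _ _ _ _ i0 i1 i2 i3 i4 i5 => exact .sig_beta i0 i1 i2 i3 i4 i5
  | pi_form _ _ i0 i1 => exact .pi_form i0 i1
  | pi_cong _ _ i0 i1 => exact .pi_cong i0 i1
  | power_form _ i0 => exact .power_form i0
  | power_cong _ _ i0 i1 => exact .power_cong i0 i1
  | pi_intro _ _ _ _ i0 i1 i2 i3 => exact .pi_intro i0 i1 i2 i3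
  | pi_intro_cong _ _ _ _ i0 i1 i2 i3 => exact .pi_intro_cong i0 i1 i2 i3
  | pi_elim _ _ _ _ _ i0 i1 i2 i3 i4 => exact .pi_elim i0 i1 i2 i3 i4
  | pi_elim_cong _ _ _ _ _ i0 i1 i2 i3 i4 => exact .pi_elim_cong i0 i1 i2 i3 i4
  | pi_beta _ _ _ _ _ i0 i1 i2 i3 i4 => exact .pi_beta i0 i1 i2 i3 i4
  | pi_eta _ _ _ _ i0 i1 i2 i3 => exact .pi_eta i0 i1 i2 i3
  | sum_form _ _ i0 i1 => exact .sum_form i0 i1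
  | sum_cong _ _ i0 i1 => exact .sum_cong i0 i1
  | sum_inl _ _ _ i0 i1 i2 => exact .sum_inl i0 i1 i2
  | sum_inl_cong _ _ _ i0 i1 i2 => exact .sum_inl_cong i0 i1 i2
  | sum_inr _ _ _ i0 i1 i2 => exact .sum_inr i0 i1 i2
  | sum_inr_cong _ _ _ i0 i1 i2 => exact .sum_inr_cong i0 i1 i2
  | sum_elim _ _ _ _ _ _ i0 i1 i2 i3 i4 i5 => exact .sum_elim i0 i1 i2 i3 i4 i5
  | sum_elim_cong _ _ _ _ _ _ i0 i1 i2 i3 i4 i5 => exact .sum_elim_cong i0 i1 i2 i3 i4 i5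
  | sum_beta_inl _ _ _ _ _ _ i0 i1 i2 i3 i4 i5 => exact .sum_beta_inl i0 i1 i2 i3 i4 i5
  | sum_beta_inr _ _ _ _ _ _ i0 i1 i2 i3 i4 i5 => exact .sum_beta_inr i0 i1 i2 i3 i4 i5
  | list_form _ i0 => exact .list_form i0
  | list_cong _ i0 => exact .list_cong i0
  | list_nil _ i0 => exact .list_nil i0
  | list_nil_cong _ i0 => exact .list_nil_cong i0
  | list_cons _ _ _ i0 i1 i2 => exact .list_cons i0 i1 i2
  | list_cons_cong _ _ _ i0 i1 i2 => exact .list_cons_cong i0 i1 i2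
  | list_elim _ _ _ _ _ i0 i1 i2 i3 i4 => exact .list_elim i0 i1 i2 i3 i4
  | list_elim_cong _ _ _ _ _ i0 i1 i2 i3 i4 => exact .list_elim_cong i0 i1 i2 i3 i4
  | list_beta_nil _ _ _ _ i0 i1 i2 i3 => exact .list_beta_nil i0 i1 i2 i3
  | list_beta_cons _ _ _ _ _ _ i0 i1 i2 i3 i4 i5 => exact .list_beta_cons i0 i1 i2 i3 i4 i5
  | quo_form _ _ _ _ _ i0 i1 i2 i3 i4 => exact .quo_form i0 i1 i2 i3 i4
  | quo_cong _ _ _ i0 i1 i2 => exact .quo_cong i0 i1 i2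
  | quo_intro _ _ i0 i1 => exact .quo_intro i0 i1
  | quo_intro_cong _ _ _ _ i0 i1 i2 i3 => exact .quo_intro_cong i0 i1 i2 i3
  | quo_eq _ _ _ _ i0 i1 i2 i3 => exact .quo_eq i0 i1 i2 i3
  | quo_eff _ _ _ _ i0 i1 i2 i3 => exact .quo_eff i0 i1 i2 i3
  | quo_elim _ _ _ _ _ i0 i1 i2 i3 i4 => exact .quo_elim i0 i1 i2 i3 i4
  | quo_elim_cong _ _ _ _ _ _ _ i0 i1 i2 i3 i4 i5 i6 => exact .quo_elim_cong i0 i1 i2 i3 i4 i5 i6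
  | quo_beta _ _ _ _ _ i0 i1 i2 i3 i4 => exact .quo_beta i0 i1 i2 i3 i4
  | pow_form _ i0 => exact .pow_form i0
  | pow_intro _ i0 => exact .pow_intro i0
  | pow_intro_cong _ _ _ i0 i1 i2 => exact .pow_intro_cong i0 i1 i2
  | pow_eq _ _ _ i0 i1 i2 => exact .pow_eq i0 i1 i2
  | pow_eff _ _ _ i0 i1 i2 => exact .pow_eff i0 i1 i2
  | pow_eq_form _ _ i0 i1 => exact .pow_eq_form i0 i1
  | pow_eq_cong _ _ i0 i1 => exact .pow_eq_cong i0 i1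
  | pow_eta _ i0 => exact .pow_eta i0
  | prop_mono _ _ _ i0 i1 i2 => exact .prop_mono i0 i1 i2
  | prop_true _ _ i0 i1 => exact .prop_true i0 i1
  | bot_form _ i0 => exact .bot_form i0
  | bot_elim _ _ i0 i1 => exact .bot_elim i0 i1
  | and_form s _ _ i0 i1 => exact .and_form s i0 i1
  | and_cong s _ _ i0 i1 => exact .and_cong s i0 i1
  | and_intro _ _ _ _ i0 i1 i2 i3 => exact .and_intro i0 i1 i2 i3
  | and_left _ _ _ i0 i1 i2 => exact .and_left i0 i1 i2
  | and_right _ _ _ i0 i1 i2 => exact .and_right i0 i1 i2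
  | or_form s _ _ i0 i1 => exact .or_form s i0 i1
  | or_cong s _ _ i0 i1 => exact .or_cong s i0 i1
  | or_left _ _ _ i0 i1 i2 => exact .or_left i0 i1 i2
  | or_right _ _ _ i0 i1 i2 => exact .or_right i0 i1 i2
  | or_elim _ _ _ _ _ _ i0 i1 i2 i3 i4 i5 => exact .or_elim i0 i1 i2 i3 i4 i5
  | imp_form s _ _ i0 i1 => exact .imp_form s i0 i1
  | imp_cong s _ _ i0 i1 => exact .imp_cong s i0 i1
  | imp_intro _ _ _ i0 i1 i2 => exact .imp_intro i0 i1 i2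
  | imp_elim _ _ _ _ i0 i1 i2 i3 => exact .imp_elim i0 i1 i2 i3
  | ex_form s _ _ i0 i1 => exact .ex_form s i0 i1
  | ex_cong s _ _ i0 i1 => exact .ex_cong s i0 i1
  | ex_intro _ _ _ _ i0 i1 i2 i3 => exact .ex_intro i0 i1 i2 i3
  | ex_elim _ _ _ _ _ i0 i1 i2 i3 i4 => exact .ex_elim i0 i1 i2 i3 i4
  | all_form s _ _ i0 i1 => exact .all_form s i0 i1
  | all_cong s _ _ i0 i1 => exact .all_cong s i0 i1
  | all_intro _ _ _ i0 i1 i2 => exact .all_intro i0 i1 i2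
  | all_elim _ _ _ _ i0 i1 i2 i3 => exact .all_elim i0 i1 i2 i3
  | eq_form s _ _ _ i0 i1 i2 => exact .eq_form s i0 i1 i2
  | eq_cong s _ _ _ i0 i1 i2 => exact .eq_cong s i0 i1 i2
  | eq_intro _ _ i0 i1 => exact .eq_intro i0 i1
  | eq_elim _ _ _ _ i0 i1 i2 i3 => exact .eq_elim i0 i1 i2 i3
  | lem h0 _ i1 => exact .lem (hl h0) i1

/-- The context of a judgement. -/
def Judgement.context : Judgement → Ctx
  | .ctx Γ => Γ
  | .typ Γ _ _ => Γ
  | .typEq Γ _ _ _ => Γ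
  | .tm Γ _ _ => Γ
  | .tmEq Γ _ _ _ => Γ

/-- Apart from the two context formation rules, every rule has a premise in the context of its
conclusion. -/
theorem Derives.context {T : Theory} {J : Judgement} (h : Derives T J) :
    Derives T (.ctx J.context) := by
  induction h <;> first | assumption | exact .ctx_nil | exact .ctx_cons ‹_› ‹_›

variable {T : Theory} {Γ Δ Θ : Ctx} {σ τ : ℕ → Expr}

/-! ### Well-typed substitutions -/

/-- `σ` is a well-typed telescopic substitution from `Δ` to `Γ`. -/
structure Sub (T : Theory) (Δ Γ : Ctx) (σ : ℕ → Expr) : Prop where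
  ctx : Derives T (.ctx Δ)
  tm : ∀ i C, Γ[i]? = some C → Derives T (.tm Δ (σ i) ((C.wk (i + 1)).subst σ))

theorem Sub.typ {k : Kind} {A : Expr} (s : Sub T Δ Γ σ) (h : Derives T (.typ Γ k A)) :
    Derives T (.typ Δ k (A.subst σ)) := .typ_subst h s.ctx s.tm

theorem Sub.typEq {k : Kind} {A B : Expr} (s : Sub T Δ Γ σ) (h : Derives T (.typEq Γ k A B)) :
    Derives T (.typEq Δ k (A.subst σ) (B.subst σ)) := .typEq_subst h s.ctx s.tm

theorem Sub.tm' {a A : Expr} (s : Sub T Δ Γ σ) (h : Derives T (.tm Γ a A)) :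
    Derives T (.tm Δ (a.subst σ) (A.subst σ)) := .tm_subst h s.ctx s.tm

theorem Sub.tmEq {a b A : Expr} (s : Sub T Δ Γ σ) (h : Derives T (.tmEq Γ a b A)) :
    Derives T (.tmEq Δ (a.subst σ) (b.subst σ) (A.subst σ)) := .tmEq_subst h s.ctx s.tm

theorem Sub.id (h : Derives T (.ctx Γ)) : Sub T Γ Γ (shift 0) :=
  ⟨h, fun i C hi => by simpa using Derives.var h hi⟩

theorem Sub.comp (s : Sub T Δ Γ σ) (t : Sub T Θ Δ τ) : Sub T Θ Γ (comp σ τ) :=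
  ⟨t.ctx, fun i C hi => by simpa using t.tm' (s.tm i C hi)⟩

theorem Sub.scons {a A : Expr} (s : Sub T Δ Γ σ) (h : Derives T (.tm Δ a (A.subst σ))) :
    Sub T Δ (A :: Γ) (a ∷ σ) := by
  refine ⟨s.ctx, fun i C hi => ?_⟩
  cases i with
  | zero => obtain rfl : A = C := by simpa using hi
            simpa using h
  | succ i => simpa [shift_succ_comp] using s.tm i C (by simpa using hi)

theorem Sub.wk {A : Expr} (h : Derives T (.typ Γ .col A)) : Sub T (A :: Γ) Γ (shift 1) := by
  have hc : Derives T (.ctx (A :: Γ)) := .ctx_cons h.context h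
  refine ⟨hc, fun i C hi => ?_⟩
  simpa [Nat.add_assoc] using Derives.var (i := i + 1) hc (by simpa using hi)

theorem var_zero {A : Expr} (h : Derives T (.typ Γ .col A)) :
    Derives T (.tm (A :: Γ) (var 0) (A.subst (shift 1))) := by
  have hc : Derives T (.ctx (A :: Γ)) := .ctx_cons h.context h
  simpa using Derives.var (i := 0) hc rfl

theorem Sub.up {A : Expr} (s : Sub T Δ Γ σ) (h : Derives T (.typ Γ .col A)) :
    Sub T (A.subst σ :: Δ) (A :: Γ) (var 0 ∷ EmTT.comp σ (shift 1)) :=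
  (s.comp (.wk (s.typ h))).scons (by simpa using var_zero (s.typ h))

theorem Sub.inst {a A : Expr} (h : Derives T (.tm Γ a A)) : Sub T Γ (A :: Γ) (a ∷ shift 0) :=
  Sub.scons (.id (Γ := Γ) h.context) (by simpa using h)

theorem prop_col {φ : Expr} (h : Derives T (.typ Γ .prop φ)) : Derives T (.typ Γ .col φ) :=
  .typ_incl .prop_col h

theorem props_prop {φ : Expr} (h : Derives T (.typ Γ .props φ)) : Derives T (.typ Γ .prop φ) :=
  .typ_incl .props_prop h

theorem set_col {A : Expr} (h : Derives T (.typ Γ .set A)) : Derives T (.typ Γ .col A) :=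
  .typ_incl .set_col h

/-- Substituting equal elements for the last variable, in a type. -/
theorem typEq_inst {k : Kind} {A B a b : Expr} (h : Derives T (.typ (A :: Γ) k B))
    (ha : Derives T (.tm Γ a A)) (hb : Derives T (.tm Γ b A))
    (hab : Derives T (.tmEq Γ a b A)) :
    Derives T (.typEq Γ k (B.subst (a ∷ shift 0)) (B.subst (b ∷ shift 0))) := by
  refine .typ_substEq h ha.context (Sub.inst ha).tm (Sub.inst hb).tm fun i C hi => ?_
  cases i with
  | zero => obtain rfl : A = C := by simpa using hi
            simpa using hab
  -- Beyond the last variable the two substitutions agree.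
  | succ i => exact .tm_refl ((Sub.inst ha).tm _ C hi)

/-! ### Intuitionistic logic -/

theorem bot_prop (h : Derives T (.ctx Γ)) : Derives T (.typ Γ .prop bot) :=
  props_prop (.bot_form h)

theorem neg_prop {φ : Expr} (h : Derives T (.typ Γ .prop φ)) :
    Derives T (.typ Γ .prop (neg φ)) := .imp_form .large h (bot_prop h.context)

theorem imp_prop {φ ψ : Expr} (h : Derives T (.typ Γ .prop φ)) (h' : Derives T (.typ Γ .prop ψ)) :
    Derives T (.typ Γ .prop (imp φ ψ)) := .imp_form .large h h'

theorem eq_prop {A a b : Expr} (h : Derives T (.typ Γ .col A)) (ha : Derives T (.tm Γ a A))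
    (hb : Derives T (.tm Γ b A)) : Derives T (.typ Γ .prop (eq A a b)) := .eq_form .large h ha hb

/-- Equal elements are propositionally equal. -/
theorem eq_of_tmEq {A a b : Expr} (hA : Derives T (.typ Γ .col A)) (ha : Derives T (.tm Γ a A))
    (h : Derives T (.tmEq Γ a b A)) : Derives T (.tm Γ tt (eq A a b)) :=
  .tm_conv (.eq_intro hA ha) (.eq_cong .large (.typ_refl hA) (.tm_refl ha) h)

/-- A hypothesis is a variable of the context. `prop_true` replaces it by the canonical proof-term,
the form used by the logical rules. -/
theorem hyp {φ : Expr} (h : Derives T (.typ Γ .prop φ)) :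
    Derives T (.tm (φ :: Γ) tt (φ.subst (shift 1))) :=
  .prop_true ((Sub.wk (prop_col h)).typ h) (var_zero (prop_col h))

theorem imp_intro {φ ψ : Expr} (hφ : Derives T (.typ Γ .prop φ)) (hψ : Derives T (.typ Γ .prop ψ))
    (h : Derives T (.tm (φ :: Γ) tt (ψ.subst (shift 1)))) : Derives T (.tm Γ tt (imp φ ψ)) :=
  .imp_intro hφ hψ (by simpa using h)

theorem neg_intro {φ : Expr} (hφ : Derives T (.typ Γ .prop φ))
    (h : Derives T (.tm (φ :: Γ) tt bot)) : Derives T (.tm Γ tt (neg φ)) :=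
  imp_intro hφ (bot_prop hφ.context) h

theorem neg_elim {φ : Expr} (hφ : Derives T (.typ Γ .prop φ))
    (h : Derives T (.tm Γ tt (neg φ))) (h' : Derives T (.tm Γ tt φ)) :
    Derives T (.tm Γ tt bot) :=
  .imp_elim hφ (bot_prop hφ.context) h h'

/-- A consequence of `φ` that is refutable makes `φ` refutable. -/
theorem neg_map {φ χ : Expr} (hφ : Derives T (.typ Γ .prop φ)) (hχ : Derives T (.typ Γ .prop χ))
    (h : Derives T (.tm Γ tt (neg χ))) (h' : Derives T (.tm (φ :: Γ) tt (χ.subst (shift 1)))) :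
    Derives T (.tm Γ tt (neg φ)) := by
  have w := Sub.wk (prop_col hφ)
  exact neg_intro hφ (neg_elim (w.typ hχ) (by simpa using w.tm' h) h')

/-- Contraposition, applied twice. -/
theorem nn_map {φ χ : Expr} (hφ : Derives T (.typ Γ .prop φ)) (hχ : Derives T (.typ Γ .prop χ))
    (h : Derives T (.tm Γ tt (neg (neg φ))))
    (h' : Derives T (.tm (φ :: Γ) tt (χ.subst (shift 1)))) :
    Derives T (.tm Γ tt (neg (neg χ))) := by
  refine neg_map (neg_prop hχ) (neg_prop hφ) h ?_
  have w := Sub.wk (prop_col (neg_prop hχ))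
  exact neg_map (w.typ hφ) (w.typ hχ) (by simpa using hyp (neg_prop hχ))
    (by simpa using (w.up (prop_col hφ)).tm' h')

theorem nn_intro {φ : Expr} (hφ : Derives T (.typ Γ .prop φ)) (h : Derives T (.tm Γ tt φ)) :
    Derives T (.tm Γ tt (neg (neg φ))) := by
  have w := Sub.wk (prop_col (neg_prop hφ))
  exact neg_intro (neg_prop hφ) (neg_elim (w.typ hφ) (by simpa using hyp (neg_prop hφ))
    (by simpa using w.tm' h))

/-- The contrapositive of φ ⇒ ¬¬φ. It makes every negation stable, in particular the translated
disjunctions and existentials. -/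
theorem neg_of_nnn {φ : Expr} (hφ : Derives T (.typ Γ .prop φ))
    (h : Derives T (.tm Γ tt (neg (neg (neg φ))))) : Derives T (.tm Γ tt (neg φ)) :=
  neg_map hφ (neg_prop (neg_prop hφ)) h
    (nn_intro ((Sub.wk (prop_col hφ)).typ hφ) (hyp hφ))

theorem top_prop (h : Derives T (.ctx Γ)) : Derives T (.typ Γ .props top) :=
  .imp_form .small (.bot_form h) (.bot_form h)

theorem top_intro (h : Derives T (.ctx Γ)) : Derives T (.tm Γ tt top) :=
  neg_intro (bot_prop h) (hyp (bot_prop h))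

/-- Excluded middle holds up to a double negation. -/
theorem nn_em {φ : Expr} (hφ : Derives T (.typ Γ .prop φ)) :
    Derives T (.tm Γ tt (neg (neg (or φ (neg φ))))) := by
  have hor : Derives T (.typ Γ .prop (or φ (neg φ))) := .or_form .large hφ (neg_prop hφ)
  have w := Sub.wk (prop_col (neg_prop hor))
  have h := hyp (neg_prop hor)
  have hφ' := w.typ hφ
  have w' := Sub.wk (prop_col hφ')
  -- If φ ∨ ¬φ is refuted, then φ is refuted through the left injection, and the right injection
  -- gives a contradiction.
  exact neg_intro (neg_prop hor) (neg_elim (w.typ hor) (by simpa using h)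
    (.or_right hφ' (neg_prop hφ') (neg_map hφ' (w.typ hor) (by simpa using h)
      (.or_left (w'.typ hφ') (neg_prop (w'.typ hφ')) (hyp hφ')))))

/-! ### Stability -/

/-- `φ` follows from its double negation. -/
def DNE (T : Theory) (Γ : Ctx) (φ : Expr) : Prop :=
  Derives T (.tm Γ tt (neg (neg φ))) → Derives T (.tm Γ tt φ)

/-- `φ` follows from its double negation in every substitution instance. -/
def StableProp (T : Theory) (Γ : Ctx) (φ : Expr) : Prop :=
  ∀ Δ σ, Sub T Δ Γ σ → DNE T Δ (φ.subst σ)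

/-- Elements of `A` are equal as soon as they are not unequal. -/
def DNEq (T : Theory) (Γ : Ctx) (A : Expr) : Prop :=
  ∀ a b, Derives T (.tm Γ a A) → Derives T (.tm Γ b A) →
    Derives T (.tm Γ tt (neg (neg (eq A a b)))) → Derives T (.tmEq Γ a b A)

/-- Elements of `A` are equal as soon as they are not unequal, in every substitution instance. -/
def StableType (T : Theory) (Γ : Ctx) (A : Expr) : Prop :=
  ∀ Δ σ, Sub T Δ Γ σ → DNEq T Δ (A.subst σ)

/-- The quantification over substitutions inside the definition reduces this to composition. -/
theorem StableProp.subst {φ : Expr} (h : StableProp T Γ φ) (s : Sub T Δ Γ σ) :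
    StableProp T Δ (φ.subst σ) := fun Θ τ t => by simpa using h Θ _ (s.comp t)

theorem StableType.subst {A : Expr} (h : StableType T Γ A) (s : Sub T Δ Γ σ) :
    StableType T Δ (A.subst σ) := fun Θ τ t => by simpa using h Θ _ (s.comp t)

theorem StableProp.dne {φ : Expr} (h : StableProp T Γ φ) (hΓ : Derives T (.ctx Γ)) :
    DNE T Γ φ := by simpa using h Γ _ (.id hΓ)

/-- The external closure condition, taken at the weakening by the hypothesis ¬¬φ itself, yields the
internal implication. -/
theorem StableProp.stable {φ : Expr} (h : StableProp T Γ φ) (hφ : Derives T (.typ Γ .prop φ)) :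
    Stable T Γ φ :=
  imp_intro (neg_prop (neg_prop hφ)) hφ
    (h _ _ (.wk (prop_col (neg_prop (neg_prop hφ)))) (hyp (neg_prop (neg_prop hφ))))

/-- The link between the two notions: stability of propositions depends on types only through their
equality. -/
theorem stableProp_eq {A a b : Expr} (h : StableType T Γ A) (hA : Derives T (.typ Γ .col A))
    (ha : Derives T (.tm Γ a A)) (hb : Derives T (.tm Γ b A)) :
    StableProp T Γ (eq A a b) := fun _ _ s hn =>
  eq_of_tmEq (s.typ hA) (s.tm' ha) (h _ _ s _ _ (s.tm' ha) (s.tm' hb) hn)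

theorem StableType.stableEq {A : Expr} (h : StableType T Γ A)
    (hA : Derives T (.typ Γ .col A)) : StableEq T Γ A := by
  have w := Sub.wk hA
  have hA' := w.typ hA
  have w' := Sub.wk hA'
  have ha := w'.tm' (var_zero hA)
  have hb := var_zero hA'
  have := (stableProp_eq ((h.subst w).subst w') (w'.typ hA') ha hb).stable
    (eq_prop (w'.typ hA') ha hb)
  simpa [StableEq] using this

/-- The form in which stability is used: when proving a stable goal, a double negation may be
dropped from a hypothesis. -/
theorem DNE.of_nn {φ χ : Expr} (h : DNE T Γ χ) (hφ : Derives T (.typ Γ .prop φ))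
    (hχ : Derives T (.typ Γ .prop χ)) (hn : Derives T (.tm Γ tt (neg (neg φ))))
    (h' : Derives T (.tm (φ :: Γ) tt (χ.subst (shift 1)))) : Derives T (.tm Γ tt χ) :=
  h (nn_map hφ hχ hn h')

/-! ### Stability under the logical constants -/

theorem stableProp_bot : StableProp T Γ bot := fun _ _ s h =>
  neg_elim (neg_prop (bot_prop s.ctx)) h (top_intro s.ctx)

theorem stableProp_neg {φ : Expr} (hφ : Derives T (.typ Γ .prop φ)) : StableProp T Γ (neg φ) :=
  fun _ _ s h => neg_of_nnn (s.typ hφ) h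

theorem stableProp_and {φ ψ : Expr} (hφ : Derives T (.typ Γ .prop φ))
    (hψ : Derives T (.typ Γ .prop ψ)) (sφ : StableProp T Γ φ) (sψ : StableProp T Γ ψ) :
    StableProp T Γ (and φ ψ) := fun _ _ s h => by
  have hφ' := s.typ hφ
  have hψ' := s.typ hψ
  have ha : Derives T (.typ _ .prop (and _ _)) := .and_form .large hφ' hψ'
  have w := Sub.wk (prop_col ha)
  exact .and_intro hφ' hψ'
    ((sφ _ _ s).of_nn ha hφ' h (.and_left (w.typ hφ') (w.typ hψ') (hyp ha)))
    ((sψ _ _ s).of_nn ha hψ' h (.and_right (w.typ hφ') (w.typ hψ') (hyp ha)))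

/-- For a fixed proof of φ, evaluation turns ¬¬(φ ⇒ ψ) into ¬¬ψ, so only the conclusion has to be
stable. Universal quantification is treated the same way, by evaluation at a generic element. -/
theorem stableProp_imp {φ ψ : Expr} (hφ : Derives T (.typ Γ .prop φ))
    (hψ : Derives T (.typ Γ .prop ψ)) (sψ : StableProp T Γ ψ) :
    StableProp T Γ (imp φ ψ) := fun _ _ s h => by
  have hφ' := s.typ hφ
  have hψ' := s.typ hψ
  have w := Sub.wk (prop_col hφ')
  have hi := imp_prop (w.typ hφ') (w.typ hψ')
  have w' := Sub.wk (prop_col hi)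
  refine imp_intro hφ' hψ' (DNE.of_nn ?_ hi (w.typ hψ') (by simpa using w.tm' h) ?_)
  · simpa using sψ _ _ (s.comp w)
  · exact .imp_elim (w'.typ (w.typ hφ')) (w'.typ (w.typ hψ')) (hyp hi)
      (by simpa using w'.tm' (hyp hφ'))

theorem stableProp_all {A φ : Expr} (hA : Derives T (.typ Γ .col A))
    (hφ : Derives T (.typ (A :: Γ) .prop φ)) (sφ : StableProp T (A :: Γ) φ) :
    StableProp T Γ (all A φ) := fun _ _ s h => by
  have hA' := s.typ hA
  have hφ' := (s.up hA).typ hφ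
  have w := Sub.wk hA'
  have hl : Derives T (.typ _ .prop (all _ _)) := .all_form .large hA' hφ'
  have hl' := w.typ hl
  have w' := Sub.wk (prop_col hl')
  refine .all_intro hA' (by simpa using hφ') (DNE.of_nn ?_ hl' (by simpa using hφ')
    (by simpa using w.tm' h) ?_)
  · simpa using sφ _ _ (s.up hA)
  · simpa using Derives.all_elim (w'.typ (w.typ hA')) ((w'.up (w.typ hA')).typ ((w.up hA').typ hφ'))
      (by simpa using hyp hl') (w'.tm' (var_zero hA'))

theorem stableType_prop {φ : Expr} (hφ : Derives T (.typ Γ .prop φ)) : StableType T Γ φ :=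
  fun _ _ s _ _ ha hb _ => .prop_mono (s.typ hφ) ha hb

/-- An element of the empty set can be eliminated towards the required equation. -/
theorem stableType_empty : StableType T Γ empty := fun Δ σ s a b ha hb _ => by
  have hE : Derives T (.typ Δ .set empty) := .empty_form s.ctx
  have w := Sub.wk (set_col hE)
  have hp := eq_prop (w.typ (set_col hE)) (w.tm' ha) (w.tm' hb)
  have := Derives.empty_elim (prop_col hp) ha
  exact .eq_elim (set_col hE) ha hb (.prop_true (eq_prop (set_col hE) ha hb) (by simpa using this))

/-! ### Stability of equality: products -/

theorem hyp_eq {A a b : Expr} (hA : Derives T (.typ Γ .col A)) (ha : Derives T (.tm Γ a A))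
    (hb : Derives T (.tm Γ b A)) :
    Derives T (.tmEq (eq A a b :: Γ) (a.subst (shift 1)) (b.subst (shift 1))
      (A.subst (shift 1))) := by
  have hp := eq_prop hA ha hb
  have w := Sub.wk (prop_col hp)
  exact .eq_elim (w.typ hA) (w.tm' ha) (w.tm' hb) (by simpa using hyp hp)

/-- To show `c = d` in a collection with stable equality, one may assume an equation that is
not refutable. -/
theorem DNEq.of_nn {A C a b c d : Expr} (h : DNEq T Γ C) (hA : Derives T (.typ Γ .col A))
    (ha : Derives T (.tm Γ a A)) (hb : Derives T (.tm Γ b A)) (hC : Derives T (.typ Γ .col C))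
    (hc : Derives T (.tm Γ c C)) (hd : Derives T (.tm Γ d C))
    (hn : Derives T (.tm Γ tt (neg (neg (eq A a b)))))
    (h' : Derives T (.tmEq (eq A a b :: Γ) (c.subst (shift 1)) (d.subst (shift 1))
      (C.subst (shift 1)))) :
    Derives T (.tmEq Γ c d C) := by
  have w := Sub.wk (prop_col (eq_prop hA ha hb))
  exact h _ _ hc hd (nn_map (eq_prop hA ha hb) (eq_prop hC hc hd) hn
    (eq_of_tmEq (w.typ hC) (w.tm' hc) h'))

/-- Functions that are not unequal have values that are not unequal at a generic argument, hence
equal values by stability of the codomain. Congruence of abstraction and η then identify the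
functions. -/
theorem dnEq_pi {A B : Expr} (hp : Derives T (.typ Γ .col (pi A B)))
    (hA : Derives T (.typ Γ .col A)) (hB : Derives T (.typ (A :: Γ) .col B))
    (sB : DNEq T (A :: Γ) B) : DNEq T Γ (pi A B) := fun f g hf hg hn => by
  have w := Sub.wk hA
  have ap_var : ∀ f, Derives T (.tm Γ f (pi A B)) → Derives T (.tm (A :: Γ)
      (ap (A.subst (shift 1)) (B.subst (var 0 ∷ shift 2)) (f.subst (shift 1)) (var 0)) B) := by
    intro f hf
    simpa using Derives.pi_elim (w.typ hp) (w.typ hA) ((w.up hA).typ hB) (w.tm' hf) (var_zero hA)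
  have w' := Sub.wk (prop_col (w.typ (eq_prop hp hf hg)))
  have key : Derives T (.tmEq (A :: Γ)
      (ap (A.subst (shift 1)) (B.subst (var 0 ∷ shift 2)) (f.subst (shift 1)) (var 0))
      (ap (A.subst (shift 1)) (B.subst (var 0 ∷ shift 2)) (g.subst (shift 1)) (var 0)) B) := by
    refine sB.of_nn (w.typ hp) (w.tm' hf) (w.tm' hg) hB (ap_var f hf) (ap_var g hg)
      (by simpa using w.tm' hn) ?_
    have e := hyp_eq (w.typ hp) (w.tm' hf) (w.tm' hg)
    have hA' := w'.typ (w.typ hA)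
    simpa using Derives.pi_elim_cong (.typ_refl (w'.typ (w.typ hp))) (.typ_refl hA')
      (.typ_refl ((w'.up (w.typ hA)).typ ((w.up hA).typ hB))) e
      (.tm_refl (w'.tm' (var_zero hA)))
  have eta : ∀ f, Derives T (.tm Γ f (pi A B)) → Derives T (.tmEq Γ (lam A B
      (ap (A.subst (shift 1)) (B.subst (var 0 ∷ shift 2)) (f.subst (shift 1)) (var 0))) f
      (pi A B)) := by
    intro f hf
    simpa using Derives.pi_eta hp hA hB hf
  exact .tm_trans (.tm_symm (eta f hf)) (.tm_trans
    (.pi_intro_cong (.typ_refl hp) (.typ_refl hA) (.typ_refl hB) key) (eta g hg))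

/-- Formation of the product is assumed because, in general, a product of collections need not be a
collection. -/
theorem stableType_pi {A B : Expr} (hp : Derives T (.typ Γ .col (pi A B)))
    (hA : Derives T (.typ Γ .col A)) (hB : Derives T (.typ (A :: Γ) .col B))
    (sB : StableType T (A :: Γ) B) : StableType T Γ (pi A B) := fun Δ σ s => by
  have u := s.up hA
  have := s.typ hp
  simp only [Expr.subst, up_eq] at this ⊢
  exact dnEq_pi this (s.typ hA) (u.typ hB) (sB _ _ u)

/-! ### Stability of equality: dependent sums -/

/-- The first projection. -/
def fst (A B d : Expr) : Expr := elSig A B (A.wk 1) d (var 1)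

@[simp] theorem subst_fst (A B d : Expr) :
    (fst A B d).subst σ = fst (A.subst σ) (B.subst (up σ)) (d.subst σ) := by simp [fst]

/-- The second projection. -/
def snd (A B d : Expr) : Expr :=
  elSig A B (B.subst (fst (A.wk 1) (B.wk₁ 1) (var 0) ∷ shift 1)) d (var 0)

@[simp] theorem subst_snd (A B d : Expr) :
    (snd A B d).subst σ = snd (A.subst σ) (B.subst (up σ)) (d.subst σ) := by simp [snd]

section Sig

variable {A B : Expr}

theorem sig_col (hA : Derives T (.typ Γ .col A)) (hB : Derives T (.typ (A :: Γ) .col B)) :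
    Derives T (.typ Γ .col (sig A B)) := .sig_form .large hA hB

theorem fst_mem_aux (hA : Derives T (.typ Γ .col A)) (hB : Derives T (.typ (A :: Γ) .col B)) :
    Derives T (.tm (B :: A :: Γ) (var 1) ((A.wk 1).subst
      (pair (A.wk 2) (B.wk₁ 2) (var 1) (var 0) ∷ shift 2))) := by
  simpa using (Sub.wk hB).tm' (var_zero hA)

theorem fst_mem {d : Expr} (hA : Derives T (.typ Γ .col A))
    (hB : Derives T (.typ (A :: Γ) .col B)) (hd : Derives T (.tm Γ d (sig A B))) :
    Derives T (.tm Γ (fst A B d) A) := by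
  have w := Sub.wk (sig_col hA hB)
  simpa [fst] using Derives.sig_elim hA hB (w.typ hA) hd (by simpa using fst_mem_aux hA hB)

theorem fst_cong {d d' : Expr} (hA : Derives T (.typ Γ .col A))
    (hB : Derives T (.typ (A :: Γ) .col B)) (hd : Derives T (.tmEq Γ d d' (sig A B))) :
    Derives T (.tmEq Γ (fst A B d) (fst A B d') A) := by
  have w := Sub.wk (sig_col hA hB)
  simpa [fst] using Derives.sig_elim_cong (.typ_refl hA) (.typ_refl hB) (.typ_refl (w.typ hA)) hd
    (by simpa using Derives.tm_refl (fst_mem_aux hA hB))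

theorem fst_beta {a b : Expr} (hA : Derives T (.typ Γ .col A))
    (hB : Derives T (.typ (A :: Γ) .col B)) (ha : Derives T (.tm Γ a A))
    (hb : Derives T (.tm Γ b (B.subst (a ∷ shift 0)))) :
    Derives T (.tmEq Γ (fst A B (pair A B a b)) a A) := by
  have w := Sub.wk (sig_col hA hB)
  simpa [fst] using Derives.sig_beta (m := var 1) hA hB (w.typ hA) ha hb (by simpa using fst_mem_aux hA hB)

/-- The second component of a pair, at the type of the second projection. -/
theorem snd_conv {a b : Expr} (hA : Derives T (.typ Γ .col A))
    (hB : Derives T (.typ (A :: Γ) .col B)) (ha : Derives T (.tm Γ a A))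
    (hb : Derives T (.tm Γ b (B.subst (a ∷ shift 0)))) :
    Derives T (.tm Γ b (B.subst (fst A B (pair A B a b) ∷ shift 0))) :=
  .tm_conv hb (typEq_inst hB ha (fst_mem hA hB (.sig_intro hA hB ha hb))
    (.tm_symm (fst_beta hA hB ha hb)))

theorem snd_type (hA : Derives T (.typ Γ .col A)) (hB : Derives T (.typ (A :: Γ) .col B)) :
    Derives T (.typ (sig A B :: Γ) .col
      (B.subst (fst (A.wk 1) (B.wk₁ 1) (var 0) ∷ shift 1))) := by
  have w := Sub.wk (sig_col hA hB)
  refine (w.scons ?_).typ hB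
  simpa using fst_mem (w.typ hA) ((w.up hA).typ hB) (var_zero (sig_col hA hB))

/-- The generic pair in the context x ∈ A, y ∈ B, typed as the rules for sums require after
weakening to that context. -/
theorem pair_vars (hA : Derives T (.typ Γ .col A)) (hB : Derives T (.typ (A :: Γ) .col B)) :
    Derives T (.typ (B :: A :: Γ) .col (A.subst (shift 2))) ∧
    Derives T (.typ (A.subst (shift 2) :: B :: A :: Γ) .col (B.subst (var 0 ∷ shift 3))) ∧
    Derives T (.tm (B :: A :: Γ) (var 1) (A.subst (shift 2))) ∧
    Derives T (.tm (B :: A :: Γ) (var 0)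
      ((B.subst (var 0 ∷ shift 3)).subst (var 1 ∷ shift 0))) := by
  have w := (Sub.wk hA).comp (.wk hB)
  refine ⟨by simpa using w.typ hA, by simpa using (w.up hA).typ hB,
    by simpa using (Sub.wk hB).tm' (var_zero hA), by simpa using var_zero hB⟩

/-- The branch of the second projection has declared type B(x), whereas the motive asks for B at the
first projection of ⟨x, y⟩. The β-rule bridges the two. -/
theorem snd_mem_aux (hA : Derives T (.typ Γ .col A)) (hB : Derives T (.typ (A :: Γ) .col B)) :
    Derives T (.tm (B :: A :: Γ) (var 0)
      ((B.subst (fst (A.wk 1) (B.wk₁ 1) (var 0) ∷ shift 1)).subst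
        (pair (A.wk 2) (B.wk₁ 2) (var 1) (var 0) ∷ shift 2))) := by
  obtain ⟨h1, h2, h3, h4⟩ := pair_vars hA hB
  simpa using snd_conv h1 h2 h3 h4

theorem snd_mem {d : Expr} (hA : Derives T (.typ Γ .col A))
    (hB : Derives T (.typ (A :: Γ) .col B)) (hd : Derives T (.tm Γ d (sig A B))) :
    Derives T (.tm Γ (snd A B d) (B.subst (fst A B d ∷ shift 0))) := by
  simpa [snd] using Derives.sig_elim hA hB (snd_type hA hB) hd (snd_mem_aux hA hB)

theorem snd_cong {d d' : Expr} (hA : Derives T (.typ Γ .col A))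
    (hB : Derives T (.typ (A :: Γ) .col B)) (hd : Derives T (.tmEq Γ d d' (sig A B))) :
    Derives T (.tmEq Γ (snd A B d) (snd A B d') (B.subst (fst A B d ∷ shift 0))) := by
  simpa [snd] using Derives.sig_elim_cong (.typ_refl hA) (.typ_refl hB)
    (.typ_refl (snd_type hA hB)) hd (.tm_refl (snd_mem_aux hA hB))

theorem snd_beta {a b : Expr} (hA : Derives T (.typ Γ .col A))
    (hB : Derives T (.typ (A :: Γ) .col B)) (ha : Derives T (.tm Γ a A))
    (hb : Derives T (.tm Γ b (B.subst (a ∷ shift 0)))) :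
    Derives T (.tmEq Γ (snd A B (pair A B a b)) b
      (B.subst (fst A B (pair A B a b) ∷ shift 0))) := by
  simpa [snd] using Derives.sig_beta hA hB (snd_type hA hB) ha hb (snd_mem_aux hA hB)

/-- Elimination towards a proposition, with the eliminator term replaced by `tt`. The induction
principles for sums, lists and quotients have the same form. -/
theorem sig_ind {φ d : Expr} (hA : Derives T (.typ Γ .col A))
    (hB : Derives T (.typ (A :: Γ) .col B)) (hφ : Derives T (.typ (sig A B :: Γ) .prop φ))
    (hd : Derives T (.tm Γ d (sig A B)))
    (h : Derives T (.tm (B :: A :: Γ) tt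
      (φ.subst (pair (A.wk 2) (B.wk₁ 2) (var 1) (var 0) ∷ shift 2)))) :
    Derives T (.tm Γ tt (φ.subst (d ∷ shift 0))) :=
  .prop_true ((Sub.inst hd).typ hφ) (.sig_elim hA hB (prop_col hφ) hd h)

theorem pair_cong {a b a' b' : Expr} (hA : Derives T (.typ Γ .col A))
    (hB : Derives T (.typ (A :: Γ) .col B)) (ha : Derives T (.tmEq Γ a a' A))
    (hb : Derives T (.tmEq Γ b b' (B.subst (a ∷ shift 0)))) :
    Derives T (.tmEq Γ (pair A B a b) (pair A B a' b') (sig A B)) :=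
  .sig_intro_cong (.typ_refl hA) (.typ_refl hB) ha hb

/-- Surjective pairing. -/
theorem sig_eta {d : Expr} (hA : Derives T (.typ Γ .col A))
    (hB : Derives T (.typ (A :: Γ) .col B)) (hd : Derives T (.tm Γ d (sig A B))) :
    Derives T (.tmEq Γ (pair A B (fst A B d) (snd A B d)) d (sig A B)) := by
  have hS := sig_col hA hB
  have pair_proj : ∀ {Γ A B d}, Derives T (.typ Γ .col A) → Derives T (.typ (A :: Γ) .col B) →
      Derives T (.tm Γ d (sig A B)) →
      Derives T (.tm Γ (pair A B (fst A B d) (snd A B d)) (sig A B)) :=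
    fun hA hB hd => .sig_intro hA hB (fst_mem hA hB hd) (snd_mem hA hB hd)
  have w := Sub.wk hS
  have hv := var_zero hS
  simp only [Expr.subst, up_eq] at hv
  have hφ := eq_prop (sig_col (w.typ hA) ((w.up hA).typ hB))
    (pair_proj (w.typ hA) ((w.up hA).typ hB) hv) hv
  refine .eq_elim hS (pair_proj hA hB hd) hd ?_
  obtain ⟨h1, h2, h3, h4⟩ := pair_vars hA hB
  have hp := Derives.sig_intro h1 h2 h3 h4
  -- On the generic pair, the equation consists of the two β-rules.
  have := eq_of_tmEq (sig_col h1 h2) (pair_proj h1 h2 hp) (pair_cong h1 h2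
    (fst_beta h1 h2 h3 h4) (snd_beta h1 h2 h3 h4))
  simpa using sig_ind hA hB hφ hd (by simpa using this)

/-- The first projections are equal by stability of A. This equation puts the second projections in
a common fibre, whose stability makes them equal, and surjective pairing concludes. -/
theorem dnEq_sig (hA : Derives T (.typ Γ .col A)) (hB : Derives T (.typ (A :: Γ) .col B))
    (sA : DNEq T Γ A) (sB : ∀ a, Derives T (.tm Γ a A) → DNEq T Γ (B.subst (a ∷ shift 0))) :
    DNEq T Γ (sig A B) := fun d d' hd hd' hn => by
  have hS := sig_col hA hB
  have w := Sub.wk (prop_col (eq_prop hS hd hd'))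
  have e := hyp_eq hS hd hd'
  simp only [Expr.subst, up_eq] at e
  have h1 := fst_mem hA hB hd
  have h2 := fst_mem hA hB hd'
  have e1 : Derives T (.tmEq Γ (fst A B d) (fst A B d') A) :=
    sA.of_nn hS hd hd' hA h1 h2 hn (by simpa using fst_cong (w.typ hA) ((w.up hA).typ hB) e)
  have e2 : Derives T (.tmEq Γ (snd A B d) (snd A B d') (B.subst (fst A B d ∷ shift 0))) :=
    (sB _ h1).of_nn hS hd hd' ((Sub.inst h1).typ hB) (snd_mem hA hB hd)
      (.tm_conv (snd_mem hA hB hd') (typEq_inst hB h2 h1 (.tm_symm e1))) hn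
      (by simpa using snd_cong (w.typ hA) ((w.up hA).typ hB) e)
  exact .tm_trans (.tm_symm (sig_eta hA hB hd)) (.tm_trans (pair_cong hA hB e1 e2)
    (sig_eta hA hB hd'))

theorem stableType_sig (hA : Derives T (.typ Γ .col A)) (hB : Derives T (.typ (A :: Γ) .col B))
    (sA : StableType T Γ A) (sB : StableType T (A :: Γ) B) : StableType T Γ (sig A B) :=
  fun Δ σ s => by
  simp only [Expr.subst, up_eq]
  refine dnEq_sig (s.typ hA) ((s.up hA).typ hB) (sA _ _ s) fun a ha => ?_
  simpa using sB _ _ (s.scons ha)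

end Sig

/-! ### Stability of equality: the singleton set -/

/-- There is no primitive η-rule for N₁. Elimination towards Eq(N₁, ⋆, x) shows that every element
equals ⋆. -/
theorem stableType_unit : StableType T Γ unit := fun Δ σ s => by
  have hU : Derives T (.typ Δ .col unit) := set_col (.unit_form s.ctx)
  have key : ∀ a, Derives T (.tm Δ a unit) → Derives T (.tmEq Δ star a unit) := by
    intro a ha
    have w := Sub.wk hU
    have hφ := eq_prop (w.typ hU) (w.tm' (.unit_intro s.ctx)) (var_zero hU)
    have h := Derives.unit_elim (prop_col hφ) ha
      (by simpa using Derives.eq_intro hU (.unit_intro s.ctx))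
    exact .eq_elim hU (.unit_intro s.ctx) ha
      (.prop_true (eq_prop hU (.unit_intro s.ctx) ha) (by simpa using h))
  exact fun a b ha hb _ => .tm_trans (.tm_symm (key a ha)) (key b hb)

/-! ### Stability of equality as a proposition -/

/-- `¬¬ Eq(A, a, b) ⇒ Eq(A, a, b)`. -/
def stab (A a b : Expr) : Expr := imp (neg (neg (eq A a b))) (eq A a b)

@[simp] theorem subst_stab (A a b : Expr) :
    (stab A a b).subst σ = stab (A.subst σ) (a.subst σ) (b.subst σ) := rfl

theorem stab_prop {A a b : Expr} (hA : Derives T (.typ Γ .col A)) (ha : Derives T (.tm Γ a A))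
    (hb : Derives T (.tm Γ b A)) : Derives T (.typ Γ .prop (stab A a b)) :=
  imp_prop (neg_prop (neg_prop (eq_prop hA ha hb))) (eq_prop hA ha hb)

/-- Sums, lists and quotients are analysed by elimination towards a proposition, so for them
stability has to be internalised as `stab`. -/
theorem stab_intro {A a b : Expr} (hA : Derives T (.typ Γ .col A)) (ha : Derives T (.tm Γ a A))
    (hb : Derives T (.tm Γ b A))
    (h : ∀ Δ σ, Sub T Δ Γ σ →
      Derives T (.tm Δ tt (neg (neg (eq (A.subst σ) (a.subst σ) (b.subst σ))))) →
      Derives T (.tmEq Δ (a.subst σ) (b.subst σ) (A.subst σ))) :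
    Derives T (.tm Γ tt (stab A a b)) := by
  have hn := neg_prop (neg_prop (eq_prop hA ha hb))
  have w := Sub.wk (prop_col hn)
  exact imp_intro hn (eq_prop hA ha hb)
    (eq_of_tmEq (w.typ hA) (w.tm' ha) (h _ _ w (by simpa using hyp hn)))

theorem stab_elim {A a b : Expr} (hA : Derives T (.typ Γ .col A)) (ha : Derives T (.tm Γ a A))
    (hb : Derives T (.tm Γ b A)) (h : Derives T (.tm Γ tt (stab A a b)))
    (hn : Derives T (.tm Γ tt (neg (neg (eq A a b))))) : Derives T (.tmEq Γ a b A) :=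
  .eq_elim hA ha hb (.imp_elim (neg_prop (neg_prop (eq_prop hA ha hb))) (eq_prop hA ha hb) h hn)

/-- Allows a case analysis on the left argument to be reused for the right one. -/
theorem stab_symm {A a b : Expr} (hA : Derives T (.typ Γ .col A)) (ha : Derives T (.tm Γ a A))
    (hb : Derives T (.tm Γ b A)) (h : Derives T (.tm Γ tt (stab A a b))) :
    Derives T (.tm Γ tt (stab A b a)) := by
  refine stab_intro hA hb ha fun Δ σ s hn => ?_
  have hA' := s.typ hA
  have w := Sub.wk (prop_col (eq_prop hA' (s.tm' hb) (s.tm' ha)))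
  exact .tm_symm (stab_elim hA' (s.tm' ha) (s.tm' hb) (s.tm' h)
    (nn_map (eq_prop hA' (s.tm' hb) (s.tm' ha)) (eq_prop hA' (s.tm' ha) (s.tm' hb)) hn
      (eq_of_tmEq (w.typ hA') (w.tm' (s.tm' ha)) (.tm_symm (hyp_eq hA' (s.tm' hb) (s.tm' ha))))))

theorem stab_refl {A a : Expr} (hA : Derives T (.typ Γ .col A)) (ha : Derives T (.tm Γ a A)) :
    Derives T (.tm Γ tt (stab A a a)) :=
  stab_intro hA ha ha fun _ _ s _ => .tm_refl (s.tm' ha)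

/-- Elements whose equality is absurd have stable equality. -/
theorem stab_of_absurd {A a b : Expr} (hA : Derives T (.typ Γ .col A))
    (ha : Derives T (.tm Γ a A)) (hb : Derives T (.tm Γ b A))
    (h : Derives T (.tm (eq A a b :: Γ) tt bot)) : Derives T (.tm Γ tt (stab A a b)) := by
  have he := eq_prop hA ha hb
  have hn := neg_prop (neg_prop he)
  have w := Sub.wk (prop_col hn)
  have := w.tm' (neg_intro he h)
  exact imp_intro hn he (.bot_elim (w.typ he) (neg_elim (w.typ (neg_prop he)) (hyp hn) this))

theorem code_top_mem (hΓ : Derives T (.ctx Γ)) : Derives T (.tm Γ (code top) pow) :=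
  .pow_intro (top_prop hΓ)

theorem code_bot_mem (hΓ : Derives T (.ctx Γ)) : Derives T (.tm Γ (code bot) pow) :=
  .pow_intro (.bot_form hΓ)

/-- Effectiveness of P(1) turns the equation into ⊤ ⇔ ⊥. For separating constructors, P(1) thus
plays the role of a universe. -/
theorem bot_of_code_eq (h : Derives T (.tmEq Γ (code top) (code bot) pow)) :
    Derives T (.tm Γ tt bot) := by
  have hΓ : Derives T (.ctx Γ) := h.context
  have ht := props_prop (top_prop hΓ)
  have hb := bot_prop hΓ
  exact .imp_elim ht hb (.and_left (imp_prop ht hb) (imp_prop hb ht)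
    (.pow_eff (top_prop hΓ) (.bot_form hΓ) h)) (top_intro hΓ)

/-! ### Stability of equality: disjoint sums -/

section Sum

variable {A B : Expr}

theorem sum_ind {φ d : Expr} (hA : Derives T (.typ Γ .set A)) (hB : Derives T (.typ Γ .set B))
    (hφ : Derives T (.typ (sum A B :: Γ) .prop φ)) (hd : Derives T (.tm Γ d (sum A B)))
    (hl : Derives T (.tm (A :: Γ) tt (φ.subst (inl (A.wk 1) (B.wk 1) (var 0) ∷ shift 1))))
    (hr : Derives T (.tm (B :: Γ) tt (φ.subst (inr (A.wk 1) (B.wk 1) (var 0) ∷ shift 1)))) :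
    Derives T (.tm Γ tt (φ.subst (d ∷ shift 0))) :=
  .prop_true ((Sub.inst hd).typ hφ) (.sum_elim hA hB (prop_col hφ) hd hl hr)

theorem sum_cases {a b : Expr} (hA : Derives T (.typ Γ .set A)) (hB : Derives T (.typ Γ .set B))
    (ha : Derives T (.tm Γ a (sum A B))) (hb : Derives T (.tm Γ b (sum A B)))
    (hl : Derives T (.tm (A :: Γ) tt (stab (sum (A.subst (shift 1)) (B.subst (shift 1)))
      (inl (A.subst (shift 1)) (B.subst (shift 1)) (var 0)) (b.subst (shift 1)))))
    (hr : Derives T (.tm (B :: Γ) tt (stab (sum (A.subst (shift 1)) (B.subst (shift 1)))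
      (inr (A.subst (shift 1)) (B.subst (shift 1)) (var 0)) (b.subst (shift 1))))) :
    Derives T (.tm Γ tt (stab (sum A B) a b)) := by
  have hS := set_col (.sum_form hA hB)
  have w := Sub.wk hS
  have := sum_ind hA hB (stab_prop (w.typ hS) (var_zero hS) (w.tm' hb)) ha (by simpa using hl)
    (by simpa using hr)
  simpa using this

/-- The left injection has a retraction, defined by elimination towards A; the element a serves as
default value on the right summand. -/
theorem inl_injective {a a' : Expr} (hA : Derives T (.typ Γ .set A))
    (hB : Derives T (.typ Γ .set B)) (ha : Derives T (.tm Γ a A)) (ha' : Derives T (.tm Γ a' A))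
    (h : Derives T (.tmEq Γ (inl A B a) (inl A B a') (sum A B))) :
    Derives T (.tmEq Γ a a' A) := by
  have hM := (Sub.wk (set_col (.sum_form hA hB))).typ (set_col hA)
  have hl := var_zero (set_col hA)
  have hr := (Sub.wk (set_col hB)).tm' ha
  have beta : ∀ x, Derives T (.tm Γ x A) → Derives T (.tmEq Γ
      (elSum A B (A.subst (shift 1)) (inl A B x) (var 0) (a.subst (shift 1))) x A) := by
    intro x hx
    simpa using Derives.sum_beta_inl (l := var 0) (r := a.subst (shift 1)) hA hB hM hx
      (by simpa using hl) (by simpa using hr)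
  have cong := Derives.sum_elim_cong (l := var 0) (r := a.subst (shift 1)) (.typ_refl hA)
    (.typ_refl hB) (.typ_refl hM) h (.tm_refl (by simpa using hl)) (.tm_refl (by simpa using hr))
  exact .tm_trans (.tm_symm (beta a ha)) (.tm_trans (by simpa using cong) (beta a' ha'))

theorem inr_injective {b b' : Expr} (hA : Derives T (.typ Γ .set A))
    (hB : Derives T (.typ Γ .set B)) (hb : Derives T (.tm Γ b B)) (hb' : Derives T (.tm Γ b' B))
    (h : Derives T (.tmEq Γ (inr A B b) (inr A B b') (sum A B))) :
    Derives T (.tmEq Γ b b' B) := by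
  have hM := (Sub.wk (set_col (.sum_form hA hB))).typ (set_col hB)
  have hl := (Sub.wk (set_col hA)).tm' hb
  have hr := var_zero (set_col hB)
  have beta : ∀ x, Derives T (.tm Γ x B) → Derives T (.tmEq Γ
      (elSum A B (B.subst (shift 1)) (inr A B x) (b.subst (shift 1)) (var 0)) x B) := by
    intro x hx
    simpa using Derives.sum_beta_inr (l := b.subst (shift 1)) (r := var 0) hA hB hM hx
      (by simpa using hl) (by simpa using hr)
  have cong := Derives.sum_elim_cong (l := b.subst (shift 1)) (r := var 0) (.typ_refl hA)
    (.typ_refl hB) (.typ_refl hM) h (.tm_refl (by simpa using hl)) (.tm_refl (by simpa using hr))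
  exact .tm_trans (.tm_symm (beta b hb)) (.tm_trans (by simpa using cong) (beta b' hb'))

/-- The map to P(1) with value [⊤] on the left summand and [⊥] on the right one separates the two.
-/
theorem inl_ne_inr {a b : Expr} (hA : Derives T (.typ Γ .set A))
    (hB : Derives T (.typ Γ .set B)) (ha : Derives T (.tm Γ a A)) (hb : Derives T (.tm Γ b B))
    (h : Derives T (.tmEq Γ (inl A B a) (inr A B b) (sum A B))) : Derives T (.tm Γ tt bot) := by
  have hΓ : Derives T (.ctx Γ) := hA.context
  have hM : Derives T (.typ (sum A B :: Γ) .col pow) :=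
    .pow_form (Sub.wk (set_col (.sum_form hA hB))).ctx
  have hl := code_top_mem (Sub.wk (set_col hA)).ctx
  have hr := code_bot_mem (Sub.wk (set_col hB)).ctx
  refine bot_of_code_eq (.tm_trans (.tm_symm ?_) (.tm_trans (Derives.sum_elim_cong (l := code top)
    (r := code bot) (.typ_refl hA) (.typ_refl hB) (.typ_refl hM) h (.tm_refl hl) (.tm_refl hr)) ?_))
  · exact .sum_beta_inl hA hB hM ha hl hr
  · exact .sum_beta_inr hA hB hM hb hl hr

theorem stab_inl_inl {a a' : Expr} (hA : Derives T (.typ Γ .set A))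
    (hB : Derives T (.typ Γ .set B)) (sA : StableType T Γ A) (ha : Derives T (.tm Γ a A))
    (ha' : Derives T (.tm Γ a' A)) :
    Derives T (.tm Γ tt (stab (sum A B) (inl A B a) (inl A B a'))) := by
  have hi := Derives.sum_inl hA hB ha
  have hi' := Derives.sum_inl hA hB ha'
  have hS := Derives.sum_form hA hB
  refine stab_intro (set_col hS) hi hi' fun Δ σ s hn => ?_
  have w := Sub.wk (prop_col (s.typ (eq_prop (set_col hS) hi hi')))
  have e := (sA _ _ s).of_nn (s.typ (set_col hS)) (s.tm' hi) (s.tm' hi') (s.typ (set_col hA))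
    (s.tm' ha) (s.tm' ha') hn (inl_injective (w.typ (s.typ hA)) (w.typ (s.typ hB))
      (w.tm' (s.tm' ha)) (w.tm' (s.tm' ha'))
      (hyp_eq (s.typ (set_col hS)) (s.tm' hi) (s.tm' hi')))
  exact .sum_inl_cong (.typ_refl (s.typ hA)) (.typ_refl (s.typ hB)) e

theorem stab_inr_inr {b b' : Expr} (hA : Derives T (.typ Γ .set A))
    (hB : Derives T (.typ Γ .set B)) (sB : StableType T Γ B) (hb : Derives T (.tm Γ b B))
    (hb' : Derives T (.tm Γ b' B)) :
    Derives T (.tm Γ tt (stab (sum A B) (inr A B b) (inr A B b'))) := by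
  have hi := Derives.sum_inr hA hB hb
  have hi' := Derives.sum_inr hA hB hb'
  have hS := Derives.sum_form hA hB
  refine stab_intro (set_col hS) hi hi' fun Δ σ s hn => ?_
  have w := Sub.wk (prop_col (s.typ (eq_prop (set_col hS) hi hi')))
  have e := (sB _ _ s).of_nn (s.typ (set_col hS)) (s.tm' hi) (s.tm' hi') (s.typ (set_col hB))
    (s.tm' hb) (s.tm' hb') hn (inr_injective (w.typ (s.typ hA)) (w.typ (s.typ hB))
      (w.tm' (s.tm' hb)) (w.tm' (s.tm' hb'))
      (hyp_eq (s.typ (set_col hS)) (s.tm' hi) (s.tm' hi')))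
  exact .sum_inr_cong (.typ_refl (s.typ hA)) (.typ_refl (s.typ hB)) e

theorem stab_inl_inr {a b : Expr} (hA : Derives T (.typ Γ .set A))
    (hB : Derives T (.typ Γ .set B)) (ha : Derives T (.tm Γ a A)) (hb : Derives T (.tm Γ b B)) :
    Derives T (.tm Γ tt (stab (sum A B) (inl A B a) (inr A B b))) := by
  have hS := set_col (.sum_form hA hB)
  have hi := Derives.sum_inl hA hB ha
  have hi' := Derives.sum_inr hA hB hb
  have w := Sub.wk (prop_col (eq_prop hS hi hi'))
  exact stab_of_absurd hS hi hi' (inl_ne_inr (w.typ hA) (w.typ hB) (w.tm' ha) (w.tm' hb)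
    (hyp_eq hS hi hi'))

theorem stab_sum {a b : Expr} (hA : Derives T (.typ Γ .set A)) (hB : Derives T (.typ Γ .set B))
    (sA : StableType T Γ A) (sB : StableType T Γ B)
    (ha : Derives T (.tm Γ a (sum A B))) (hb : Derives T (.tm Γ b (sum A B))) :
    Derives T (.tm Γ tt (stab (sum A B) a b)) := by
  -- The case split on the second argument, stated for all contexts because it is applied after the
  -- first split has extended the context.
  have step : ∀ {Γ A B x b}, Derives T (.typ Γ .set A) → Derives T (.typ Γ .set B) →
      StableType T Γ A → StableType T Γ B → Derives T (.tm Γ b (sum A B)) →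
      (Derives T (.tm Γ x A) → Derives T (.tm Γ tt (stab (sum A B) (inl A B x) b))) ∧
      (Derives T (.tm Γ x B) → Derives T (.tm Γ tt (stab (sum A B) (inr A B x) b))) := by
    intro Γ A B x b hA hB sA sB hb
    have wA := Sub.wk (set_col hA)
    have wB := Sub.wk (set_col hB)
    have hS := set_col (.sum_form hA hB)
    have vA := var_zero (set_col hA)
    have vB := var_zero (set_col hB)
    constructor
    · intro hx
      refine stab_symm hS hb (.sum_inl hA hB hx) (sum_cases hA hB hb (.sum_inl hA hB hx) ?_ ?_)
      · exact stab_inl_inl (wA.typ hA) (wA.typ hB) (sA.subst wA) vA (wA.tm' hx)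
      · exact stab_symm (wB.typ hS) (wB.tm' (.sum_inl hA hB hx)) (.sum_inr (wB.typ hA) (wB.typ hB) vB)
          (stab_inl_inr (wB.typ hA) (wB.typ hB) (wB.tm' hx) vB)
    · intro hx
      refine stab_symm hS hb (.sum_inr hA hB hx) (sum_cases hA hB hb (.sum_inr hA hB hx) ?_ ?_)
      · exact stab_inl_inr (wA.typ hA) (wA.typ hB) vA (wA.tm' hx)
      · exact stab_inr_inr (wB.typ hA) (wB.typ hB) (sB.subst wB) vB (wB.tm' hx)
  have wA := Sub.wk (set_col hA)
  have wB := Sub.wk (set_col hB)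
  exact sum_cases hA hB ha hb
    ((step (wA.typ hA) (wA.typ hB) (sA.subst wA) (sB.subst wA) (wA.tm' hb)).1
      (var_zero (set_col hA)))
    ((step (wB.typ hA) (wB.typ hB) (sA.subst wB) (sB.subst wB) (wB.tm' hb)).2
      (var_zero (set_col hB)))

theorem stableType_sum (hA : Derives T (.typ Γ .set A)) (hB : Derives T (.typ Γ .set B))
    (sA : StableType T Γ A) (sB : StableType T Γ B) : StableType T Γ (sum A B) :=
  fun _ _ s _ _ ha hb hn =>
  stab_elim (s.typ (set_col (.sum_form hA hB))) ha hb
    (stab_sum (s.typ hA) (s.typ hB) (sA.subst s) (sB.subst s) ha hb) hn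

end Sum

/-! ### Stability of equality: lists -/

section List

variable {A : Expr}

theorem list_col (hA : Derives T (.typ Γ .set A)) : Derives T (.typ Γ .col (list A)) :=
  set_col (.list_form hA)

theorem list_ind {φ s : Expr} (hA : Derives T (.typ Γ .set A))
    (hφ : Derives T (.typ (list A :: Γ) .prop φ)) (hs : Derives T (.tm Γ s (list A)))
    (hn : Derives T (.tm Γ tt (φ.subst (nil A ∷ shift 0))))
    (hc : Derives T (.tm (φ.subst (var 1 ∷ shift 2) :: A.wk 1 :: list A :: Γ) tt
      (φ.subst (cons (A.wk 3) (var 2) (var 1) ∷ shift 3)))) :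
    Derives T (.tm Γ tt (φ.subst (s ∷ shift 0))) :=
  .prop_true ((Sub.inst hs).typ hφ) (.list_elim hA (prop_col hφ) hs hn hc)

/-- The context `x ∈ List(A), y ∈ A, z ∈ M(x)` of a recursion on lists. -/
theorem list_vars {M : Expr} (hA : Derives T (.typ Γ .set A))
    (hM : Derives T (.typ (list A :: Γ) .col M)) :
    Sub T (A.subst (shift 1) :: list A :: Γ) Γ (shift 2) ∧
    Derives T (.tm (A.subst (shift 1) :: list A :: Γ) (var 1) (list (A.subst (shift 2)))) ∧
    Derives T (.tm (A.subst (shift 1) :: list A :: Γ) (var 0) (A.subst (shift 2))) ∧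
    Derives T (.typ (A.subst (shift 1) :: list A :: Γ) .col (M.subst (var 1 ∷ shift 2))) := by
  have w := Sub.wk (list_col hA)
  have w' := Sub.wk (set_col (w.typ hA))
  have hx := w'.tm' (var_zero (list_col hA))
  simp only [Expr.subst, subst_subst, shift_comp_shift, shift_apply] at hx
  have w2 := w.comp w'
  rw [shift_comp_shift] at w2
  exact ⟨w2, hx, by simpa using var_zero (set_col (w.typ hA)), (w2.scons hx).typ hM⟩

/-- List induction in which the induction hypothesis is discarded by weakening. -/
theorem list_cases {a b : Expr} (hA : Derives T (.typ Γ .set A))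
    (ha : Derives T (.tm Γ a (list A))) (hb : Derives T (.tm Γ b (list A)))
    (hn : Derives T (.tm Γ tt (stab (list A) (nil A) b)))
    (hc : Derives T (.tm (A.subst (shift 1) :: list A :: Γ) tt (stab (list (A.subst (shift 2)))
      (cons (A.subst (shift 2)) (var 1) (var 0)) (b.subst (shift 2))))) :
    Derives T (.tm Γ tt (stab (list A) a b)) := by
  have hL := list_col hA
  have w := Sub.wk hL
  have hφ := stab_prop (w.typ hL) (var_zero hL) (w.tm' hb)
  obtain ⟨-, -, -, h4⟩ := list_vars hA (prop_col hφ)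
  have := list_ind hA hφ ha (by simpa using hn) (by simpa using (Sub.wk h4).tm' hc)
  simpa using this

/-- The tail function is recursion with branch `var 2`, the tail in the context x, y, z of the
branch, and default value the empty list. For the head, the branch is `var 1` and the default is a.
-/
theorem tail_injective {s s' a a' : Expr} (hA : Derives T (.typ Γ .set A))
    (hs : Derives T (.tm Γ s (list A))) (hs' : Derives T (.tm Γ s' (list A)))
    (ha : Derives T (.tm Γ a A)) (ha' : Derives T (.tm Γ a' A))
    (h : Derives T (.tmEq Γ (cons A s a) (cons A s' a') (list A))) :
    Derives T (.tmEq Γ s s' (list A)) := by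
  have hL := list_col hA
  have hM := (Sub.wk hL).typ hL
  obtain ⟨-, h2, -, h4⟩ := list_vars hA hM
  have hl := (Sub.wk h4).tm' h2
  have hn := Derives.list_nil hA
  have beta : ∀ s a, Derives T (.tm Γ s (list A)) → Derives T (.tm Γ a A) →
      Derives T (.tmEq Γ (elList A (list (A.subst (shift 1))) (cons A s a) (nil A) (var 2)) s
        (list A)) := by
    intro s a hs ha
    simpa using Derives.list_beta_cons (l := var 2) (a := nil A) hA hM hs ha
      (by simpa using hn) (by simpa using hl)
  have cong := Derives.list_elim_cong (l := var 2) (a := nil A) (.typ_refl hA)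
    (.typ_refl hM) h (.tm_refl (by simpa using hn)) (.tm_refl (by simpa using hl))
  exact .tm_trans (.tm_symm (beta s a hs ha)) (.tm_trans (by simpa using cong) (beta s' a' hs' ha'))

theorem head_injective {s s' a a' : Expr} (hA : Derives T (.typ Γ .set A))
    (hs : Derives T (.tm Γ s (list A))) (hs' : Derives T (.tm Γ s' (list A)))
    (ha : Derives T (.tm Γ a A)) (ha' : Derives T (.tm Γ a' A))
    (h : Derives T (.tmEq Γ (cons A s a) (cons A s' a') (list A))) :
    Derives T (.tmEq Γ a a' A) := by
  have hL := list_col hA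
  have hM := (Sub.wk hL).typ (set_col hA)
  obtain ⟨-, -, h3, h4⟩ := list_vars hA hM
  have hl := (Sub.wk h4).tm' h3
  have beta : ∀ s x, Derives T (.tm Γ s (list A)) → Derives T (.tm Γ x A) →
      Derives T (.tmEq Γ (elList A (A.subst (shift 1)) (cons A s x) a (var 1)) x A) := by
    intro s x hs hx
    simpa using Derives.list_beta_cons (l := var 1) (a := a) hA hM hs hx
      (by simpa using ha) (by simpa using hl)
  have cong := Derives.list_elim_cong (l := var 1) (a := a) (.typ_refl hA)
    (.typ_refl hM) h (.tm_refl (by simpa using ha)) (.tm_refl (by simpa using hl))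
  exact .tm_trans (.tm_symm (beta s a hs ha)) (.tm_trans (by simpa using cong) (beta s' a' hs' ha'))

/-- Recursion towards P(1), with [⊤] at the empty list and [⊥] at the others, separates them. -/
theorem nil_ne_cons {s a : Expr} (hA : Derives T (.typ Γ .set A))
    (hs : Derives T (.tm Γ s (list A))) (ha : Derives T (.tm Γ a A))
    (h : Derives T (.tmEq Γ (nil A) (cons A s a) (list A))) : Derives T (.tm Γ tt bot) := by
  have hΓ : Derives T (.ctx Γ) := hA.context
  have hM : Derives T (.typ (list A :: Γ) .col pow) := .pow_form (Sub.wk (list_col hA)).ctx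
  obtain ⟨-, -, -, h4⟩ := list_vars hA hM
  have hl := code_bot_mem (Sub.wk h4).ctx
  refine bot_of_code_eq (.tm_trans (.tm_symm ?_) (.tm_trans (Derives.list_elim_cong (a := code top)
    (l := code bot) (.typ_refl hA) (.typ_refl hM) h (.tm_refl (code_top_mem hΓ))
    (.tm_refl (by simpa using hl))) ?_))
  · exact .list_beta_nil hA hM (code_top_mem hΓ) (by simpa using hl)
  · exact .list_beta_cons hA hM hs ha (code_top_mem hΓ) (by simpa using hl)

theorem stab_nil_cons {s a : Expr} (hA : Derives T (.typ Γ .set A))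
    (hs : Derives T (.tm Γ s (list A))) (ha : Derives T (.tm Γ a A)) :
    Derives T (.tm Γ tt (stab (list A) (nil A) (cons A s a))) := by
  have hL := list_col hA
  have hn := Derives.list_nil hA
  have hc := Derives.list_cons hA hs ha
  have w := Sub.wk (prop_col (eq_prop hL hn hc))
  exact stab_of_absurd hL hn hc (nil_ne_cons (w.typ hA) (w.tm' hs) (w.tm' ha) (hyp_eq hL hn hc))

theorem stab_nil {b : Expr} (hA : Derives T (.typ Γ .set A)) (hb : Derives T (.tm Γ b (list A))) :
    Derives T (.tm Γ tt (stab (list A) (nil A) b)) := by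
  have hL := list_col hA
  have hn := Derives.list_nil hA
  obtain ⟨w, h2, h3, -⟩ := list_vars hA ((Sub.wk hL).typ hL)
  refine stab_symm hL hb hn (list_cases hA hb hn (stab_refl hL hn) ?_)
  exact stab_symm (w.typ hL) (w.tm' hn) (.list_cons (w.typ hA) h2 h3)
    (stab_nil_cons (w.typ hA) h2 h3)

/-- By injectivity, heads and tails are not unequal. Heads are then equal by stability of A, tails
by the assumption on s and s'. -/
theorem stab_cons_cons {s s' a a' : Expr} (hA : Derives T (.typ Γ .set A))
    (sA : StableType T Γ A) (hs : Derives T (.tm Γ s (list A)))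
    (hs' : Derives T (.tm Γ s' (list A))) (ha : Derives T (.tm Γ a A))
    (ha' : Derives T (.tm Γ a' A)) (h : Derives T (.tm Γ tt (stab (list A) s s'))) :
    Derives T (.tm Γ tt (stab (list A) (cons A s a) (cons A s' a'))) := by
  have hL := list_col hA
  have hc := Derives.list_cons hA hs ha
  have hc' := Derives.list_cons hA hs' ha'
  refine stab_intro hL hc hc' fun Δ σ u hn => ?_
  have w := Sub.wk (prop_col (u.typ (eq_prop hL hc hc')))
  have e := hyp_eq (u.typ hL) (u.tm' hc) (u.tm' hc')
  have wA := w.typ (u.typ hA)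
  have ws := w.tm' (u.tm' hs)
  have ws' := w.tm' (u.tm' hs')
  have wa := w.tm' (u.tm' ha)
  have wa' := w.tm' (u.tm' ha')
  have hp := eq_prop (u.typ hL) (u.tm' hc) (u.tm' hc')
  have es := stab_elim (u.typ hL) (u.tm' hs) (u.tm' hs') (u.tm' h)
    (nn_map hp (eq_prop (u.typ hL) (u.tm' hs) (u.tm' hs')) hn
      (eq_of_tmEq (w.typ (u.typ hL)) ws (tail_injective wA ws ws' wa wa' e)))
  have ea := (sA _ _ u).of_nn (u.typ hL) (u.tm' hc) (u.tm' hc') (u.typ (set_col hA))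
    (u.tm' ha) (u.tm' ha') hn (head_injective wA ws ws' wa wa' e)
  exact .list_cons_cong (.typ_refl (u.typ hA)) es ea

/-- `s` is equal to every list not unequal to it. -/
def stabAll (A s : Expr) : Expr :=
  all (list A) (stab (list (A.subst (shift 1))) (s.subst (shift 1)) (var 0))

@[simp] theorem subst_stabAll (A s : Expr) :
    (stabAll A s).subst σ = stabAll (A.subst σ) (s.subst σ) := by simp [stabAll]

theorem stabAll_body {s : Expr} (hA : Derives T (.typ Γ .set A))
    (hs : Derives T (.tm Γ s (list A))) : Derives T (.typ (list A :: Γ) .prop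
      (stab (list (A.subst (shift 1))) (s.subst (shift 1)) (var 0))) := by
  have w := Sub.wk (list_col hA)
  exact stab_prop (w.typ (list_col hA)) (w.tm' hs) (var_zero (list_col hA))

theorem stabAll_prop {s : Expr} (hA : Derives T (.typ Γ .set A))
    (hs : Derives T (.tm Γ s (list A))) : Derives T (.typ Γ .prop (stabAll A s)) :=
  .all_form .large (list_col hA) (stabAll_body hA hs)

theorem stabAll_elim {s b : Expr} (hA : Derives T (.typ Γ .set A))
    (hs : Derives T (.tm Γ s (list A))) (hb : Derives T (.tm Γ b (list A)))
    (h : Derives T (.tm Γ tt (stabAll A s))) : Derives T (.tm Γ tt (stab (list A) s b)) := by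
  simpa using Derives.all_elim (list_col hA) (stabAll_body hA hs) h hb

theorem stab_cons {s a b : Expr} (hA : Derives T (.typ Γ .set A)) (sA : StableType T Γ A)
    (hs : Derives T (.tm Γ s (list A))) (ha : Derives T (.tm Γ a A))
    (hb : Derives T (.tm Γ b (list A))) (h : Derives T (.tm Γ tt (stabAll A s))) :
    Derives T (.tm Γ tt (stab (list A) (cons A s a) b)) := by
  have hL := list_col hA
  have hc := Derives.list_cons hA hs ha
  obtain ⟨w, h2, h3, -⟩ := list_vars hA ((Sub.wk hL).typ hL)
  refine stab_symm hL hb hc (list_cases hA hb hc (stab_nil_cons hA hs ha) ?_)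
  refine stab_symm (w.typ hL) (w.tm' hc) (.list_cons (w.typ hA) h2 h3) ?_
  exact stab_cons_cons (w.typ hA) (sA.subst w) (w.tm' hs) h2 (w.tm' ha) h3
    (stabAll_elim (w.typ hA) (w.tm' hs) h2 (by simpa using w.tm' h))

/-- Induction on the first list, with the second universally quantified: the step needs the
induction hypothesis at the tail of the second list. -/
theorem stab_list {a b : Expr} (hA : Derives T (.typ Γ .set A)) (sA : StableType T Γ A)
    (ha : Derives T (.tm Γ a (list A))) (hb : Derives T (.tm Γ b (list A))) :
    Derives T (.tm Γ tt (stab (list A) a b)) := by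
  have hL := list_col hA
  have w := Sub.wk hL
  have hφ := stabAll_prop (w.typ hA) (var_zero hL)
  refine stabAll_elim hA ha hb ?_
  obtain ⟨w2, h2, h3, h4⟩ := list_vars hA (prop_col hφ)
  have w3 := w2.comp (.wk h4)
  have hA3 := w3.typ hA
  have hx := (Sub.wk h4).tm' h2
  have hy := (Sub.wk h4).tm' h3
  have ih := hyp ((w2.scons h2).typ hφ)
  simp only [subst_subst, subst_stabAll, shift_comp_shift, Expr.subst,
    shift_one_comp, scons_zero, shift_apply, Nat.reduceAdd, zero_add] at hA3 hx hy ih w3 h4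
  have v := Sub.wk (list_col hA3)
  have step := Derives.all_intro (list_col hA3) (stabAll_body hA3 (.list_cons hA3 hx hy))
    (stab_cons (v.typ hA3) ((sA.subst w3).subst v) (v.tm' hx) (v.tm' hy) (var_zero (list_col hA3))
      (by simpa using v.tm' ih))
  have base := Derives.all_intro hL (stabAll_body hA (.list_nil hA))
    (stab_nil (w.typ hA) (var_zero hL))
  have := list_ind hA hφ ha (by simpa [stabAll] using base) (by simpa [stabAll] using step)
  simpa using this

theorem stableType_list (hA : Derives T (.typ Γ .set A)) (sA : StableType T Γ A) :
    StableType T Γ (list A) := fun _ _ s _ _ ha hb hn =>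
  stab_elim (s.typ (list_col hA)) ha hb (stab_list (s.typ hA) (sA.subst s) ha hb) hn

end List

/-! ### Stability of equality: quotients -/

section Quo

variable {A R : Expr}

theorem quo_ind {φ d : Expr} (hQ : Derives T (.typ Γ .set (quo A R)))
    (hA : Derives T (.typ Γ .col A)) (hR : Derives T (.typ (A.wk 1 :: A :: Γ) .col R))
    (hφ : Derives T (.typ (quo A R :: Γ) .prop φ)) (hd : Derives T (.tm Γ d (quo A R)))
    (h : Derives T (.tm (A :: Γ) tt
      (φ.subst (cls (A.wk 1) (R.wk₂ 1) (var 0) ∷ shift 1)))) :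
    Derives T (.tm Γ tt (φ.subst (d ∷ shift 0))) := by
  refine .prop_true ((Sub.inst hd).typ hφ) (.quo_elim hQ (prop_col hφ) hd h ?_)
  have w := Sub.wk hA
  rw [wk_eq_subst] at hR
  have w2 := w.comp ((Sub.wk (w.typ hA)).comp (.wk hR))
  have hv := (Sub.wk hR).tm' ((Sub.wk (w.typ hA)).tm' (var_zero hA))
  rw [shift_comp_shift, shift_comp_shift] at w2
  -- Compatibility with the relation is immediate, since both instances of the branch are `tt`.
  simpa using Derives.tm_refl ((w2.scons (a := var 2) (by simpa using hv)).tm' h)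

theorem quo_cases {a b : Expr} (hQ : Derives T (.typ Γ .set (quo A R)))
    (hA : Derives T (.typ Γ .col A)) (hR : Derives T (.typ (A.wk 1 :: A :: Γ) .col R))
    (ha : Derives T (.tm Γ a (quo A R))) (hb : Derives T (.tm Γ b (quo A R)))
    (h : Derives T (.tm (A :: Γ) tt (stab ((quo A R).subst (shift 1))
      (cls (A.subst (shift 1)) (R.subst (up (up (shift 1)))) (var 0)) (b.subst (shift 1))))) :
    Derives T (.tm Γ tt (stab (quo A R) a b)) := by
  have w := Sub.wk (set_col hQ)
  have := quo_ind hQ hA hR (stab_prop (w.typ (set_col hQ)) (var_zero (set_col hQ)) (w.tm' hb)) ha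
    (by simpa using h)
  simpa using this

/-- Effectiveness turns an equation of classes that is not refutable into ¬¬R(a, b). Stability of R
removes the double negation, and related elements have equal classes. -/
theorem stab_cls_cls {a b : Expr} (hQ : Derives T (.typ Γ .set (quo A R)))
    (hR : Derives T (.typ (A.wk 1 :: A :: Γ) .prop R))
    (sR : StableProp T (A.wk 1 :: A :: Γ) R) (ha : Derives T (.tm Γ a A))
    (hb : Derives T (.tm Γ b A)) :
    Derives T (.tm Γ tt (stab (quo A R) (cls A R a) (cls A R b))) := by
  have hQ' := set_col hQ
  have hc := Derives.quo_intro hQ ha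
  have hc' := Derives.quo_intro hQ hb
  refine stab_intro hQ' hc hc' fun Δ σ s hn => ?_
  have u : Sub T Δ (A.wk 1 :: A :: Γ) (b.subst σ ∷ a.subst σ ∷ σ) :=
    (s.scons (s.tm' ha)).scons (by simpa using s.tm' hb)
  have hp := eq_prop (s.typ hQ') (s.tm' hc) (s.tm' hc')
  have w := Sub.wk (prop_col hp)
  have eff := Derives.quo_eff (w.typ (s.typ hQ)) (w.tm' (s.tm' ha)) (w.tm' (s.tm' hb))
    (hyp_eq (s.typ hQ') (s.tm' hc) (s.tm' hc'))
  have r := (sR _ _ u).of_nn hp (u.typ hR) hn (by simpa using eff)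
  exact .quo_eq (s.typ hQ) (s.tm' ha) (s.tm' hb) (by simpa using r)

theorem stab_quo {a b : Expr} (hQ : Derives T (.typ Γ .set (quo A R)))
    (hA : Derives T (.typ Γ .col A)) (hR : Derives T (.typ (A.wk 1 :: A :: Γ) .prop R))
    (sR : StableProp T (A.wk 1 :: A :: Γ) R) (ha : Derives T (.tm Γ a (quo A R)))
    (hb : Derives T (.tm Γ b (quo A R))) : Derives T (.tm Γ tt (stab (quo A R) a b)) := by
  have lift : ∀ {Δ σ}, Sub T Δ Γ σ →
      Sub T ((A.subst σ).wk 1 :: A.subst σ :: Δ) (A.wk 1 :: A :: Γ) (up (up σ)) := by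
    intro Δ σ s
    simpa using (s.up hA).up ((Sub.wk hA).typ hA)
  -- Representatives are chosen one at a time; here the first argument is already a class and the
  -- second is arbitrary.
  have step : ∀ {Δ σ x b}, Sub T Δ Γ σ → Derives T (.tm Δ x (A.subst σ)) →
      Derives T (.tm Δ b ((quo A R).subst σ)) → Derives T (.tm Δ tt
        (stab ((quo A R).subst σ) (cls (A.subst σ) (R.subst (up (up σ))) x) b)) := by
    intro Δ σ x b s hx hb
    have hc := Derives.quo_intro (s.typ hQ) hx
    have hAs := s.typ hA
    have w := Sub.wk hAs
    have l := lift (s.comp w)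
    have hR' := l.typ hR
    refine stab_symm (s.typ (set_col hQ)) hb hc
      (quo_cases (s.typ hQ) hAs ((lift s).typ (prop_col hR)) hb hc ?_)
    have := stab_cls_cls ((s.comp w).typ hQ) hR' (sR.subst l)
      (a := var 0) (b := x.subst (shift 1)) (by simpa using var_zero hAs) (by simpa using w.tm' hx)
    simpa using this
  have w := Sub.wk hA
  exact quo_cases hQ hA (prop_col hR) ha hb (step w (var_zero hA) (w.tm' hb))

theorem stableType_quo (hQ : Derives T (.typ Γ .set (quo A R)))
    (hA : Derives T (.typ Γ .col A)) (hR : Derives T (.typ (A.wk 1 :: A :: Γ) .prop R))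
    (sR : StableProp T (A.wk 1 :: A :: Γ) R) : StableType T Γ (quo A R) := by
  intro Δ σ s a b ha hb hn
  have l : Sub T ((A.subst σ).wk 1 :: A.subst σ :: Δ) (A.wk 1 :: A :: Γ) (up (up σ)) := by
    simpa using (s.up hA).up ((Sub.wk hA).typ hA)
  exact stab_elim (s.typ (set_col hQ)) ha hb
    (stab_quo (s.typ hQ) (s.typ hA) (l.typ hR) (sR.subst l) ha hb) hn

end Quo

/-! ### The translation of the power collection -/

/-- The collection of the stable elements of `P(1)`. -/
abbrev stablePowCol : Expr := sig pow stablePow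

/-- The element of the translated power collection given by a stable proposition. -/
abbrev stableCode (φ : Expr) : Expr := pair pow stablePow (code φ) tt

theorem subst_stablePow_scons (a : Expr) (σ : ℕ → Expr) :
    stablePow.subst (a ∷ σ) = imp (neg (neg (dc a))) (dc a) := rfl

theorem pow_col (h : Derives T (.ctx Γ)) : Derives T (.typ Γ .col pow) := .pow_form h

theorem dc_props {U : Expr} (h : Derives T (.tm Γ U pow)) : Derives T (.typ Γ .props (dc U)) :=
  .pow_eq_form h (code_top_mem h.context)

theorem dc_prop {U : Expr} (h : Derives T (.tm Γ U pow)) : Derives T (.typ Γ .prop (dc U)) :=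
  props_prop (dc_props h)

theorem stablePow_prop (h : Derives T (.ctx Γ)) :
    Derives T (.typ (pow :: Γ) .prop stablePow) := by
  have hv := dc_prop (var_zero (pow_col h))
  exact imp_prop (neg_prop (neg_prop hv)) hv

theorem stablePowCol_col (h : Derives T (.ctx Γ)) : Derives T (.typ Γ .col stablePowCol) :=
  sig_col (pow_col h) (prop_col (stablePow_prop h))

theorem iff_intro {φ ψ : Expr} (hφ : Derives T (.typ Γ .prop φ)) (hψ : Derives T (.typ Γ .prop ψ))
    (h : Derives T (.tm (φ :: Γ) tt (ψ.subst (shift 1))))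
    (h' : Derives T (.tm (ψ :: Γ) tt (φ.subst (shift 1)))) : Derives T (.tm Γ tt (Expr.iff φ ψ)) :=
  .and_intro (imp_prop hφ hψ) (imp_prop hψ hφ) (imp_intro hφ hψ h) (imp_intro hψ hφ h')

/-- A provable proposition has the code of the true one. -/
theorem dc_code_intro {φ : Expr} (hφ : Derives T (.typ Γ .props φ))
    (h : Derives T (.tm Γ tt φ)) : Derives T (.tm Γ tt (dc (code φ))) := by
  have hΓ : Derives T (.ctx Γ) := hφ.context
  have ht := top_prop hΓ
  have w := Sub.wk (prop_col (props_prop hφ))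
  have w' := Sub.wk (prop_col (props_prop ht))
  exact eq_of_tmEq (pow_col hΓ) (.pow_intro hφ) (.pow_eq hφ ht
    (iff_intro (props_prop hφ) (props_prop ht) (top_intro w.ctx) (w'.tm' h)))

theorem dc_code_elim {φ : Expr} (hφ : Derives T (.typ Γ .props φ))
    (h : Derives T (.tm Γ tt (dc (code φ)))) : Derives T (.tm Γ tt φ) := by
  have hΓ : Derives T (.ctx Γ) := hφ.context
  have ht := props_prop (top_prop hΓ)
  have e := Derives.eq_elim (pow_col hΓ) (.pow_intro hφ) (code_top_mem hΓ) h
  exact .imp_elim ht (props_prop hφ) (.and_right (imp_prop (props_prop hφ) ht)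
    (imp_prop ht (props_prop hφ)) (.pow_eff hφ (top_prop hΓ) e)) (top_intro hΓ)

/-- Dc([φ]) and φ are interderivable, so stability transfers from φ. -/
theorem stableProp_dc_code {φ : Expr} (hφ : Derives T (.typ Γ .props φ))
    (sφ : StableProp T Γ φ) : StableProp T Γ (dc (code φ)) := fun Δ σ s hn => by
  have hφ' := s.typ hφ
  have hd := dc_prop (.pow_intro hφ')
  have w := Sub.wk (prop_col hd)
  exact dc_code_intro hφ' ((sφ _ _ s).of_nn hd (props_prop hφ') hn
    (dc_code_elim (w.typ hφ') (hyp hd)))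

theorem stableCode_mem {φ : Expr} (hφ : Derives T (.typ Γ .props φ)) (sφ : StableProp T Γ φ) :
    Derives T (.tm Γ (stableCode φ) stablePowCol) :=
  have hΓ : Derives T (.ctx Γ) := hφ.context
  .sig_intro (pow_col hΓ) (prop_col (stablePow_prop hΓ)) (.pow_intro hφ)
    ((stableProp_dc_code hφ sφ).stable (dc_prop (.pow_intro hφ)))

/-- The underlying element of `P(1)`. -/
abbrev underlying (d : Expr) : Expr := fst pow stablePow d

theorem underlying_mem {d : Expr} (hd : Derives T (.tm Γ d stablePowCol)) :
    Derives T (.tm Γ (underlying d) pow) :=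
  fst_mem (pow_col hd.context) (prop_col (stablePow_prop hd.context)) hd

theorem underlying_cong {d d' : Expr} (h : Derives T (.tmEq Γ d d' stablePowCol)) :
    Derives T (.tmEq Γ (underlying d) (underlying d') pow) :=
  fst_cong (pow_col h.context) (prop_col (stablePow_prop h.context)) h

theorem underlying_stableCode {φ : Expr} (hφ : Derives T (.typ Γ .props φ))
    (sφ : StableProp T Γ φ) : Derives T (.tmEq Γ (underlying (stableCode φ)) (code φ) pow) :=
  have hΓ : Derives T (.ctx Γ) := hφ.context
  fst_beta (pow_col hΓ) (prop_col (stablePow_prop hΓ)) (.pow_intro hφ)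
    ((stableProp_dc_code hφ sφ).stable (dc_prop (.pow_intro hφ)))

/-- The second projection of d proves exactly the implication needed. -/
theorem dne_dc_underlying {d : Expr} (hd : Derives T (.tm Γ d stablePowCol)) :
    DNE T Γ (dc (underlying d)) := fun hn => by
  have hΓ : Derives T (.ctx Γ) := hd.context
  have hu := dc_prop (underlying_mem hd)
  have hp := imp_prop (neg_prop (neg_prop hu)) hu
  have h := snd_mem (pow_col hΓ) (prop_col (stablePow_prop hΓ)) hd
  rw [subst_stablePow_scons] at h
  exact .imp_elim (neg_prop (neg_prop hu)) hu (.prop_true hp h) hn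

/-- Elements of the translated power collection are equal when the underlying ones are. -/
theorem stablePowCol_ext {d d' : Expr} (hd : Derives T (.tm Γ d stablePowCol))
    (hd' : Derives T (.tm Γ d' stablePowCol))
    (h : Derives T (.tmEq Γ (underlying d) (underlying d') pow)) :
    Derives T (.tmEq Γ d d' stablePowCol) := by
  have hΓ : Derives T (.ctx Γ) := hd.context
  have hP := pow_col hΓ
  have hS := stablePow_prop hΓ
  have hu := underlying_mem hd
  have hu' := underlying_mem hd'
  have h2 := Derives.tm_conv (snd_mem hP (prop_col hS) hd')
    (typEq_inst (prop_col hS) hu' hu (.tm_symm h))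
  -- After conversion, the second projections prove the same proposition, so proof irrelevance
  -- identifies them.
  exact .tm_trans (.tm_symm (sig_eta hP (prop_col hS) hd)) (.tm_trans
    (pair_cong hP (prop_col hS) h (.prop_mono ((Sub.inst hu).typ hS)
      (snd_mem hP (prop_col hS) hd) h2)) (sig_eta hP (prop_col hS) hd'))

/-- `stableType_sig` is of no help, as it would require stable equality on P(1). Instead, elements
are determined by their decodings. If d and d' are not unequal, each decoding implies the double
negation of the other, and both are stable. -/
theorem stableType_stablePowCol : StableType T Γ stablePowCol := fun Δ σ s d d' hd hd' hn => by
  simp only [Expr.subst, up_eq, subst_stablePow] at hd hd' hn ⊢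
  have hC := stablePowCol_col s.ctx
  have half : ∀ d d', Derives T (.tm Δ d stablePowCol) → Derives T (.tm Δ d' stablePowCol) →
      Derives T (.tm Δ tt (neg (neg (eq stablePowCol d d')))) →
      Derives T (.tm (dc (underlying d) :: Δ) tt (dc ((underlying d').subst (shift 1)))) := by
    intro d d' hd hd' hn
    have hu := dc_prop (underlying_mem hd)
    have w := Sub.wk (prop_col hu)
    have he := w.typ (eq_prop hC hd hd')
    have w' := Sub.wk (prop_col he)
    have key := DNE.of_nn (dne_dc_underlying (w.tm' hd')) he
      (dc_prop (underlying_mem (w.tm' hd'))) (w.tm' hn) ?_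
    · simpa using key
    have e := underlying_cong (hyp_eq (w.typ hC) (w.tm' hd) (w.tm' hd'))
    have e' := Derives.eq_elim (pow_col w'.ctx) (w'.tm' (w.tm' (underlying_mem hd)))
      (code_top_mem w'.ctx) (w'.tm' (hyp hu))
    have hm := w'.tm' (w.tm' (underlying_mem hd'))
    refine eq_of_tmEq (pow_col w'.ctx) (by simpa using hm) ?_
    exact .tm_trans (.tm_symm (by simpa using e)) (by simpa using e')
  have hn' : Derives T (.tm Δ tt (neg (neg (eq stablePowCol d' d)))) := by
    have w := Sub.wk (prop_col (eq_prop hC hd hd'))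
    exact nn_map (eq_prop hC hd hd') (eq_prop hC hd' hd) hn
      (eq_of_tmEq (w.typ hC) (w.tm' hd') (.tm_symm (hyp_eq hC hd hd')))
  have hu := underlying_mem hd
  have hu' := underlying_mem hd'
  refine stablePowCol_ext hd hd' (.tm_trans (.tm_symm (.pow_eta hu)) (.tm_trans
    (.pow_eq (dc_props hu) (dc_props hu') ?_) (.pow_eta hu')))
  exact iff_intro (dc_prop hu) (dc_prop hu') (half d d' hd hd' hn) (half d' d hd' hd hn')

theorem stableProp_top (h : Derives T (.ctx Γ)) : StableProp T Γ top := stableProp_neg (bot_prop h)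

/-- Every element of the translated power collection is the code of its decoding. -/
theorem stablePowCol_eta {d : Expr} (hd : Derives T (.tm Γ d stablePowCol))
    (he : Derives T (.typ Γ .props (eq stablePowCol d (stableCode top)))) :
    Derives T (.tmEq Γ (stableCode (eq stablePowCol d (stableCode top))) d stablePowCol) := by
  have hΓ : Derives T (.ctx Γ) := hd.context
  have hC := stablePowCol_col hΓ
  have ht := stableCode_mem (top_prop hΓ) (stableProp_top hΓ)
  have hs := stableProp_eq stableType_stablePowCol hC hd ht
  have hu := underlying_mem hd
  refine stablePowCol_ext (stableCode_mem he hs) hd (.tm_trans (underlying_stableCode he hs)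
    (.tm_trans (.pow_eq he (dc_props hu) ?_) (.pow_eta hu)))
  -- Equality with the translated [⊤] is equiprovable with the decoding of the underlying element:
  -- in one direction by projecting, in the other by extensionality.
  refine iff_intro (props_prop he) (dc_prop hu) ?_ ?_
  · have w := Sub.wk (prop_col (props_prop he))
    have e := underlying_cong (hyp_eq hC hd ht)
    have e' := underlying_stableCode (top_prop w.ctx) (stableProp_top w.ctx)
    have hm := w.tm' hu
    refine eq_of_tmEq (pow_col w.ctx) hm (.tm_trans ?_ e')
    simpa using e
  · have w := Sub.wk (prop_col (dc_prop hu))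
    have e := hyp_eq (pow_col hΓ) hu (code_top_mem hΓ)
    have e' := underlying_stableCode (top_prop w.ctx) (stableProp_top w.ctx)
    have key := stablePowCol_ext (w.tm' hd) (w.tm' ht)
      (.tm_trans e (.tm_symm e'))
    exact eq_of_tmEq (w.typ hC) (w.tm' hd) key

/-! ### The interpretation -/

/-- A kind of propositions. -/
def Kind.IsProp (k : Kind) : Prop := k = .props ∨ k = .prop

/-- The translation of a judgement is derivable with resizing, and moreover translated types
have stable equality and translated propositions are stable. -/
def Interp : Judgement → Prop
  | .ctx Γ => Derives emTTImp (.ctx (Ctx.dn Γ))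
  | .typ Γ k A => Derives emTTImp (.typ (Ctx.dn Γ) k A.dn) ∧ StableType emTTImp (Ctx.dn Γ) A.dn ∧
      (k.IsProp → StableProp emTTImp (Ctx.dn Γ) A.dn)
  | .typEq Γ k A B => Derives emTTImp (.typEq (Ctx.dn Γ) k A.dn B.dn)
  | .tm Γ a A => Derives emTTImp (.tm (Ctx.dn Γ) a.dn A.dn)
  | .tmEq Γ a b A => Derives emTTImp (.tmEq (Ctx.dn Γ) a.dn b.dn A.dn)

theorem Interp.derives {J : Judgement} (h : Interp J) : Derives emTTImp J.dn := by
  cases J <;> first | exact h | exact h.1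

section

variable {φ A : Expr}

/-! ### Kinds, sizes and resizing -/

theorem Size.pr_isProp (s : Size) : s.pr.IsProp := by cases s <;> simp [Size.pr, Kind.IsProp]

theorem Size.ty_not_isProp (s : Size) : ¬ s.ty.IsProp := by
  cases s <;> simp [Size.ty, Kind.IsProp]

theorem Size.prop (s : Size) (h : Derives T (.typ Γ s.pr φ)) : Derives T (.typ Γ .prop φ) := by
  cases s
  · exact props_prop h
  · exact h

theorem Size.col (s : Size) (h : Derives T (.typ Γ s.ty A)) : Derives T (.typ Γ .col A) := by
  cases s
  · exact set_col h
  · exact h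

/-- Large propositions are small under resizing. -/
theorem prop_props (h : Derives emTTImp (.typ Γ .prop φ)) : Derives emTTImp (.typ Γ .props φ) :=
  .typ_resize rfl .prop_props h

theorem prop_pr (s : Size) (h : Derives emTTImp (.typ Γ .prop φ)) :
    Derives emTTImp (.typ Γ s.pr φ) := by
  cases s
  · exact prop_props h
  · exact h

theorem neg_cong {φ' : Expr} (s : Size) (h : Derives T (.typEq Γ s.pr φ φ')) :
    Derives T (.typEq Γ s.pr (neg φ) (neg φ')) := by
  refine .imp_cong s h (.typ_refl ?_)
  cases s
  · exact .bot_form h.context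
  · exact bot_prop h.context

/-- Smallness comes from resizing and stable equality from proof irrelevance. For a proposition this
leaves large well-formedness and stability. -/
theorem Interp.prop {Γ : Ctx} {φ : Expr} (s : Size)
    (h : Derives emTTImp (.typ (Ctx.dn Γ) .prop φ.dn))
    (hs : StableProp emTTImp (Ctx.dn Γ) φ.dn) : Interp (.typ Γ s.pr φ) :=
  ⟨prop_pr s h, stableType_prop h, fun _ => hs⟩

theorem Interp.set {Γ : Ctx} {A : Expr} (s : Size)
    (h : Derives emTTImp (.typ (Ctx.dn Γ) s.ty A.dn))
    (hs : StableType emTTImp (Ctx.dn Γ) A.dn) : Interp (.typ Γ s.ty A) :=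
  ⟨h, hs, fun hp => (s.ty_not_isProp hp).elim⟩

theorem Interp.sub {Γ Δ : Ctx} {σ : ℕ → Expr} (hΔ : Interp (.ctx Δ))
    (h : ∀ i C, Γ[i]? = some C → Interp (.tm Δ (σ i) ((C.wk (i + 1)).subst σ))) :
    Sub emTTImp (Ctx.dn Δ) (Ctx.dn Γ) (dnSubst σ) := by
  refine ⟨hΔ, fun i C hi => ?_⟩
  obtain ⟨D, hD, rfl⟩ : ∃ D, Γ[i]? = some D ∧ D.dn = C := by simpa [Ctx.dn] using hi
  rw [← dn_wk, ← dn_subst]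
  exact h i D hD

theorem Interp.subEq {Γ Δ : Ctx} {σ τ : ℕ → Expr}
    (h : ∀ i C, Γ[i]? = some C → Interp (.tmEq Δ (σ i) (τ i) ((C.wk (i + 1)).subst σ))) :
    ∀ i C, (Ctx.dn Γ)[i]? = some C → Derives emTTImp
      (.tmEq (Ctx.dn Δ) (dnSubst σ i) (dnSubst τ i) ((C.wk (i + 1)).subst (dnSubst σ))) := by
  intro i C hi
  obtain ⟨D, hD, rfl⟩ : ∃ D, Γ[i]? = some D ∧ D.dn = C := by simpa [Ctx.dn] using hi
  rw [← dn_wk, ← dn_subst]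
  exact h i D hD

/-- Elimination of a double-negated disjunction towards a stable proposition. -/
theorem nn_or_elim {ψ χ : Expr} (hφ : Derives T (.typ Γ .prop φ)) (hψ : Derives T (.typ Γ .prop ψ))
    (hχ : Derives T (.typ Γ .prop χ)) (sχ : StableProp T Γ χ)
    (h : Derives T (.tm Γ tt (neg (neg (or φ ψ)))))
    (hl : Derives T (.tm (φ :: Γ) tt (χ.wk 1))) (hr : Derives T (.tm (ψ :: Γ) tt (χ.wk 1))) :
    Derives T (.tm Γ tt χ) := by
  have ho : Derives T (.typ Γ .prop (or φ ψ)) := .or_form .large hφ hψ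
  have w := Sub.wk (prop_col ho)
  exact (sχ.dne hφ.context).of_nn ho hχ h (.or_elim (w.typ hφ) (w.typ hψ) (w.typ hχ) (hyp ho)
    (by simpa using (w.up (prop_col hφ)).tm' hl) (by simpa using (w.up (prop_col hψ)).tm' hr))

/-- Elimination of a double-negated existential quantification towards a stable proposition. -/
theorem nn_ex_elim {χ : Expr} (hA : Derives T (.typ Γ .col A))
    (hφ : Derives T (.typ (A :: Γ) .prop φ)) (hχ : Derives T (.typ Γ .prop χ))
    (sχ : StableProp T Γ χ) (h : Derives T (.tm Γ tt (neg (neg (ex A φ)))))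
    (he : Derives T (.tm (φ :: A :: Γ) tt (χ.wk 2))) : Derives T (.tm Γ tt χ) := by
  have ho : Derives T (.typ Γ .prop (ex A φ)) := .ex_form .large hA hφ
  have w := Sub.wk (prop_col ho)
  have h' := hyp ho
  have u := (w.up hA).up (prop_col hφ)
  simp only [Expr.subst, up_eq] at h'
  exact (sχ.dne hA.context).of_nn ho hχ h (.ex_elim (w.typ hA) ((w.up hA).typ hφ) (w.typ hχ) h'
    (by simpa using u.tm' he))

theorem or_prop {ψ : Expr} (hφ : Derives T (.typ Γ .prop φ)) (hψ : Derives T (.typ Γ .prop ψ)) :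
    Derives T (.typ Γ .prop (or φ ψ)) := .or_form .large hφ hψ

theorem ex_prop (hA : Derives T (.typ Γ .col A)) (hφ : Derives T (.typ (A :: Γ) .prop φ)) :
    Derives T (.typ Γ .prop (ex A φ)) := .ex_form .large hA hφ

/-- Resizing admits the translated P(1) as codomain of a product of sets and makes its equality
small. -/
theorem stablePowCol_set (h : Derives emTTImp (.ctx Γ)) :
    Derives emTTImp (.typ Γ .set stablePowCol) :=
  .typ_resize rfl .col_set (stablePowCol_col h)

end

/-- The translation interprets the classical theory, with stable types. -/
theorem Derives.interp {J : Judgement} (h : Derives emTTcImp J) : Interp J := by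
  induction h with
  | ctx_nil =>
    exact Derives.ctx_nil
  | ctx_cons _ _ i0 i1 =>
    exact Derives.ctx_cons i0 i1.1
  | var _ h1 i0 =>
    simp only [Interp, dn_wk]
    exact .var i0 (by simp [Ctx.dn, h1])
  | typ_subst _ _ _ i0 i1 i2 =>
    have s := Interp.sub i1 i2
    simp only [Interp, dn_subst]
    exact ⟨s.typ i0.1, i0.2.1.subst s, fun hk => (i0.2.2 hk).subst s⟩
  | typEq_subst _ _ _ i0 i1 i2 =>
    simp only [Interp, dn_subst]
    exact (Interp.sub i1 i2).typEq i0
  | tm_subst _ _ _ i0 i1 i2 =>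
    simp only [Interp, dn_subst]
    exact (Interp.sub i1 i2).tm' i0
  | tmEq_subst _ _ _ i0 i1 i2 =>
    simp only [Interp, dn_subst]
    exact (Interp.sub i1 i2).tmEq i0
  | typ_substEq _ _ _ _ _ i0 i1 i2 i3 i4 =>
    simp only [Interp, dn_subst]
    exact .typ_substEq i0.1 i1 (Interp.sub i1 i2).tm (Interp.sub i1 i3).tm (Interp.subEq i4)
  | tm_substEq _ _ _ _ _ i0 i1 i2 i3 i4 =>
    simp only [Interp, dn_subst]
    exact .tm_substEq i0 i1 (Interp.sub i1 i2).tm (Interp.sub i1 i3).tm (Interp.subEq i4)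
  | typ_refl _ i0 =>
    exact Derives.typ_refl i0.1
  | typ_symm _ i0 =>
    exact Derives.typ_symm i0
  | typ_trans _ _ i0 i1 =>
    exact Derives.typ_trans i0 i1
  | tm_refl _ i0 =>
    exact Derives.tm_refl i0
  | tm_symm _ i0 =>
    exact Derives.tm_symm i0
  | tm_trans _ _ i0 i1 =>
    exact Derives.tm_trans i0 i1
  | tm_conv _ _ i0 i1 =>
    exact Derives.tm_conv i0 i1
  | tmEq_conv _ _ i0 i1 =>
    exact Derives.tmEq_conv i0 i1
  | typ_incl h0 _ i1 =>
    refine ⟨.typ_incl h0 i1.1, i1.2.1, fun hk => i1.2.2 ?_⟩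
    cases h0 <;> simp_all [Kind.IsProp]
  | typEq_incl h0 _ i1 =>
    exact Derives.typEq_incl h0 i1
  | typ_resize _ h1 _ i2 =>
    refine ⟨.typ_resize rfl h1 i2.1, i2.2.1, fun hk => i2.2.2 ?_⟩
    cases h1 <;> simp_all [Kind.IsProp]
  | typEq_resize _ h1 _ i2 =>
    exact Derives.typEq_resize rfl h1 i2
  | empty_form _ i0 =>
    exact .set .small (.empty_form i0) stableType_empty
  | empty_elim _ _ i0 i1 =>
    simp only [Interp, Ctx.dn, List.map_cons, Expr.dn, dn_inst] at i0 i1 ⊢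
    exact .empty_elim i0.1 i1
  | empty_elim_cong _ _ i0 i1 =>
    simp only [Interp, Ctx.dn, List.map_cons, Expr.dn, dn_inst] at i0 i1 ⊢
    exact .empty_elim_cong i0 i1
  | unit_form _ i0 =>
    exact .set .small (.unit_form i0) stableType_unit
  | unit_intro _ i0 =>
    exact Derives.unit_intro i0
  | unit_elim _ _ _ i0 i1 i2 =>
    simp only [Interp, Ctx.dn, List.map_cons, Expr.dn, dn_inst] at i0 i1 i2 ⊢
    exact .unit_elim i0.1 i1 i2
  | unit_elim_cong _ _ _ i0 i1 i2 =>
    simp only [Interp, Ctx.dn, List.map_cons, Expr.dn, dn_inst] at i0 i1 i2 ⊢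
    exact .unit_elim_cong i0 i1 i2
  | unit_beta _ _ i0 i1 =>
    simp only [Interp, Ctx.dn, List.map_cons, Expr.dn, dn_inst] at i0 i1 ⊢
    exact .unit_beta i0.1 i1
  | sig_form s _ _ i0 i1 =>
    exact .set s (.sig_form s i0.1 i1.1) (stableType_sig (s.col i0.1) (s.col i1.1) i0.2.1 i1.2.1)
  | sig_cong s _ _ i0 i1 =>
    simp only [Interp, Ctx.dn, List.map_cons, Expr.dn] at i0 i1 ⊢
    exact .sig_cong s i0 i1
  | sig_intro _ _ _ _ i0 i1 i2 i3 =>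
    simp only [Interp, Ctx.dn, List.map_cons, Expr.dn, dn_inst] at i0 i1 i2 i3 ⊢
    exact .sig_intro i0.1 i1.1 i2 i3
  | sig_intro_cong _ _ _ _ i0 i1 i2 i3 =>
    simp only [Interp, Ctx.dn, List.map_cons, Expr.dn, dn_inst] at i0 i1 i2 i3 ⊢
    exact .sig_intro_cong i0 i1 i2 i3
  | sig_elim _ _ _ _ _ i0 i1 i2 i3 i4 =>
    simp only [Interp, Ctx.dn, List.map_cons, Expr.dn, dn_subst, dn_inst, dn_wk, dn_wk₁, dnSubst_scons, dnSubst_shift] at i0 i1 i2 i3 i4 ⊢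
    exact .sig_elim i0.1 i1.1 i2.1 i3 i4
  | sig_elim_cong _ _ _ _ _ i0 i1 i2 i3 i4 =>
    simp only [Interp, Ctx.dn, List.map_cons, Expr.dn, dn_subst, dn_inst, dn_wk, dn_wk₁, dnSubst_scons, dnSubst_shift] at i0 i1 i2 i3 i4 ⊢
    exact .sig_elim_cong i0 i1 i2 i3 i4
  | sig_beta _ _ _ _ _ _ i0 i1 i2 i3 i4 i5 =>
    simp only [Interp, Ctx.dn, List.map_cons, Expr.dn, dn_subst, dn_inst, dn_wk, dn_wk₁, dnSubst_scons, dnSubst_shift] at i0 i1 i2 i3 i4 i5 ⊢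
    exact .sig_beta i0.1 i1.1 i2.1 i3 i4 i5
  | pi_form _ _ i0 i1 =>
    have hp := Derives.pi_form i0.1 i1.1
    exact .set .small hp (stableType_pi (set_col hp) (set_col i0.1) (set_col i1.1) i1.2.1)
  | pi_cong _ _ i0 i1 =>
    simp only [Interp, Ctx.dn, List.map_cons, Expr.dn] at i0 i1 ⊢
    exact .pi_cong i0 i1
  | power_form _ i0 =>
    have hA := set_col i0.1
    have hc := (Sub.wk hA).ctx
    -- The translation of A → P(1) no longer has P(1) as codomain, so `power_form` does not apply to
    -- it; by resizing it is a product of sets.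
    have hp := set_col (.pi_form i0.1 (stablePowCol_set hc))
    exact .set .large hp (stableType_pi hp hA (stablePowCol_col hc) stableType_stablePowCol)
  | power_cong _ _ i0 i1 =>
    exact Derives.typEq_incl .set_col (.pi_cong i1 (.typ_refl (stablePowCol_set (Sub.wk (set_col i0.1)).ctx)))
  | pi_intro _ _ _ _ i0 i1 i2 i3 =>
    simp only [Interp, Ctx.dn, List.map_cons, Expr.dn] at i0 i1 i2 i3 ⊢
    exact .pi_intro i0.1 i1.1 i2.1 i3
  | pi_intro_cong _ _ _ _ i0 i1 i2 i3 =>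
    simp only [Interp, Ctx.dn, List.map_cons, Expr.dn] at i0 i1 i2 i3 ⊢
    exact .pi_intro_cong i0 i1 i2 i3
  | pi_elim _ _ _ _ _ i0 i1 i2 i3 i4 =>
    simp only [Interp, Ctx.dn, List.map_cons, Expr.dn, dn_inst] at i0 i1 i2 i3 i4 ⊢
    exact .pi_elim i0.1 i1.1 i2.1 i3 i4
  | pi_elim_cong _ _ _ _ _ i0 i1 i2 i3 i4 =>
    simp only [Interp, Ctx.dn, List.map_cons, Expr.dn, dn_inst] at i0 i1 i2 i3 i4 ⊢
    exact .pi_elim_cong i0 i1 i2 i3 i4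
  | pi_beta _ _ _ _ _ i0 i1 i2 i3 i4 =>
    simp only [Interp, Ctx.dn, List.map_cons, Expr.dn, dn_inst] at i0 i1 i2 i3 i4 ⊢
    exact .pi_beta i0.1 i1.1 i2.1 i3 i4
  | pi_eta _ _ _ _ i0 i1 i2 i3 =>
    simp only [Interp, Ctx.dn, List.map_cons, Expr.dn, dn_wk, dn_wk₁] at i0 i1 i2 i3 ⊢
    exact .pi_eta i0.1 i1.1 i2.1 i3
  | sum_form _ _ i0 i1 =>
    exact .set .small (.sum_form i0.1 i1.1) (stableType_sum i0.1 i1.1 i0.2.1 i1.2.1)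
  | sum_cong _ _ i0 i1 =>
    exact Derives.sum_cong i0 i1
  | sum_inl _ _ _ i0 i1 i2 =>
    exact Derives.sum_inl i0.1 i1.1 i2
  | sum_inl_cong _ _ _ i0 i1 i2 =>
    exact Derives.sum_inl_cong i0 i1 i2
  | sum_inr _ _ _ i0 i1 i2 =>
    exact Derives.sum_inr i0.1 i1.1 i2
  | sum_inr_cong _ _ _ i0 i1 i2 =>
    exact Derives.sum_inr_cong i0 i1 i2
  | sum_elim _ _ _ _ _ _ i0 i1 i2 i3 i4 i5 =>
    simp only [Interp, Ctx.dn, List.map_cons, Expr.dn, dn_subst, dn_inst, dn_wk, dnSubst_scons, dnSubst_shift] at i0 i1 i2 i3 i4 i5 ⊢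
    exact .sum_elim i0.1 i1.1 i2.1 i3 i4 i5
  | sum_elim_cong _ _ _ _ _ _ i0 i1 i2 i3 i4 i5 =>
    simp only [Interp, Ctx.dn, List.map_cons, Expr.dn, dn_subst, dn_inst, dn_wk, dnSubst_scons, dnSubst_shift] at i0 i1 i2 i3 i4 i5 ⊢
    exact .sum_elim_cong i0 i1 i2 i3 i4 i5
  | sum_beta_inl _ _ _ _ _ _ i0 i1 i2 i3 i4 i5 =>
    simp only [Interp, Ctx.dn, List.map_cons, Expr.dn, dn_subst, dn_inst, dn_wk, dnSubst_scons, dnSubst_shift] at i0 i1 i2 i3 i4 i5 ⊢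
    exact .sum_beta_inl i0.1 i1.1 i2.1 i3 i4 i5
  | sum_beta_inr _ _ _ _ _ _ i0 i1 i2 i3 i4 i5 =>
    simp only [Interp, Ctx.dn, List.map_cons, Expr.dn, dn_subst, dn_inst, dn_wk, dnSubst_scons, dnSubst_shift] at i0 i1 i2 i3 i4 i5 ⊢
    exact .sum_beta_inr i0.1 i1.1 i2.1 i3 i4 i5
  | list_form _ i0 =>
    exact .set .small (.list_form i0.1) (stableType_list i0.1 i0.2.1)
  | list_cong _ i0 =>
    exact Derives.list_cong i0
  | list_nil _ i0 =>
    exact Derives.list_nil i0.1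
  | list_nil_cong _ i0 =>
    exact Derives.list_nil_cong i0
  | list_cons _ _ _ i0 i1 i2 =>
    exact Derives.list_cons i0.1 i1 i2
  | list_cons_cong _ _ _ i0 i1 i2 =>
    exact Derives.list_cons_cong i0 i1 i2
  | list_elim _ _ _ _ _ i0 i1 i2 i3 i4 =>
    simp only [Interp, Ctx.dn, List.map_cons, Expr.dn, dn_subst, dn_inst, dn_wk, dnSubst_scons, dnSubst_shift] at i0 i1 i2 i3 i4 ⊢
    exact .list_elim i0.1 i1.1 i2 i3 i4
  | list_elim_cong _ _ _ _ _ i0 i1 i2 i3 i4 =>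
    simp only [Interp, Ctx.dn, List.map_cons, Expr.dn, dn_subst, dn_inst, dn_wk, dnSubst_scons, dnSubst_shift] at i0 i1 i2 i3 i4 ⊢
    exact .list_elim_cong i0 i1 i2 i3 i4
  | list_beta_nil _ _ _ _ i0 i1 i2 i3 =>
    simp only [Interp, Ctx.dn, List.map_cons, Expr.dn, dn_subst, dn_inst, dn_wk, dnSubst_scons, dnSubst_shift] at i0 i1 i2 i3 ⊢
    exact .list_beta_nil i0.1 i1.1 i2 i3
  | list_beta_cons _ _ _ _ _ _ i0 i1 i2 i3 i4 i5 =>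
    simp only [Interp, Ctx.dn, List.map_cons, Expr.dn, dn_subst, dn_inst, dn_wk, dnSubst_scons, dnSubst_shift] at i0 i1 i2 i3 i4 i5 ⊢
    exact .list_beta_cons i0.1 i1.1 i2 i3 i4 i5
  | quo_form _ _ _ _ _ i0 i1 i2 i3 i4 =>
    simp only [Interp, Ctx.dn, List.map_cons, Expr.dn, dn_subst, dn_wk, dnSubst_scons, dnSubst_shift] at i0 i1 i2 i3 i4
    have hQ := Derives.quo_form i0.1 i1.1 i2 i3 i4
    exact .set .small hQ
      -- The relation is a small proposition, hence stable by the induction hypothesis.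
      (stableType_quo hQ (set_col i0.1) (props_prop i1.1) (i1.2.2 (.inl rfl)))
  | quo_cong _ _ _ i0 i1 i2 =>
    simp only [Interp, Ctx.dn, List.map_cons, Expr.dn, dn_wk] at i0 i1 i2 ⊢
    exact .quo_cong i0.1 i1 i2
  | quo_intro _ _ i0 i1 =>
    exact Derives.quo_intro i0.1 i1
  | quo_intro_cong _ _ _ _ i0 i1 i2 i3 =>
    simp only [Interp, Ctx.dn, List.map_cons, Expr.dn, dn_wk] at i0 i1 i2 i3 ⊢
    exact .quo_intro_cong i0.1 i1 i2 i3
  | quo_eq _ _ _ _ i0 i1 i2 i3 =>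
    simp only [Interp, Expr.dn, dn_subst, dnSubst_scons, dnSubst_shift] at i0 i1 i2 i3 ⊢
    exact .quo_eq i0.1 i1 i2 i3
  | quo_eff _ _ _ _ i0 i1 i2 i3 =>
    simp only [Interp, Expr.dn, dn_subst, dnSubst_scons, dnSubst_shift] at i0 i1 i2 i3 ⊢
    exact .quo_eff i0.1 i1 i2 i3
  | quo_elim _ _ _ _ _ i0 i1 i2 i3 i4 =>
    simp only [Interp, Ctx.dn, List.map_cons, Expr.dn, dn_subst, dn_inst, dn_wk, dn_wk₂, dnSubst_scons, dnSubst_shift] at i0 i1 i2 i3 i4 ⊢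
    exact .quo_elim i0.1 i1.1 i2 i3 i4
  | quo_elim_cong _ _ _ _ _ _ _ i0 i1 i2 i3 i4 i5 i6 =>
    simp only [Interp, Ctx.dn, List.map_cons, Expr.dn, dn_subst, dn_inst, dn_wk, dn_wk₂, dnSubst_scons, dnSubst_shift] at i0 i1 i2 i3 i4 i5 i6 ⊢
    exact .quo_elim_cong i0.1 i1 i2 i3 i4 i5 i6
  | quo_beta _ _ _ _ _ i0 i1 i2 i3 i4 =>
    simp only [Interp, Ctx.dn, List.map_cons, Expr.dn, dn_subst, dn_inst, dn_wk, dn_wk₂, dnSubst_scons, dnSubst_shift] at i0 i1 i2 i3 i4 ⊢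
    exact .quo_beta i0.1 i1.1 i2 i3 i4
  | pow_form _ i0 =>
    exact .set .large (stablePowCol_col i0) stableType_stablePowCol
  | pow_intro _ i0 =>
    exact stableCode_mem i0.1 (i0.2.2 (.inl rfl))
  | pow_intro_cong _ _ _ i0 i1 i2 =>
    exact stablePowCol_ext (stableCode_mem i0.1 (i0.2.2 (.inl rfl)))
      (stableCode_mem i1.1 (i1.2.2 (.inl rfl)))
      (.tm_trans (underlying_stableCode i0.1 (i0.2.2 (.inl rfl)))
        (.tm_trans (.pow_intro_cong i0.1 i1.1 i2)
          (.tm_symm (underlying_stableCode i1.1 (i1.2.2 (.inl rfl))))))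
  | pow_eq _ _ _ i0 i1 i2 =>
    exact stablePowCol_ext (stableCode_mem i0.1 (i0.2.2 (.inl rfl)))
      (stableCode_mem i1.1 (i1.2.2 (.inl rfl)))
      (.tm_trans (underlying_stableCode i0.1 (i0.2.2 (.inl rfl)))
        (.tm_trans (.pow_eq i0.1 i1.1 i2)
          (.tm_symm (underlying_stableCode i1.1 (i1.2.2 (.inl rfl))))))
  | pow_eff _ _ _ i0 i1 i2 =>
    -- Projecting to P(1) recovers the original codes, to which effectiveness applies.
    exact Derives.pow_eff i0.1 i1.1
      (.tm_trans (.tm_symm (underlying_stableCode i0.1 (i0.2.2 (.inl rfl))))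
        (.tm_trans (underlying_cong i2) (underlying_stableCode i1.1 (i1.2.2 (.inl rfl)))))
  | pow_eq_form _ _ i0 i1 =>
    exact .prop .small (eq_prop (stablePowCol_col i0.context) i0 i1)
      (stableProp_eq stableType_stablePowCol (stablePowCol_col i0.context) i0 i1)
  | pow_eq_cong _ _ i0 i1 =>
    exact Derives.eq_cong .small (.typ_refl (stablePowCol_set i0.context)) i0 i1
  | pow_eta _ i0 =>
    have hc := stablePowCol_col i0.context
    exact stablePowCol_eta i0 (prop_props (eq_prop hc i0
      (stableCode_mem (top_prop i0.context) (stableProp_top i0.context))))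
  | prop_mono _ _ _ i0 i1 i2 =>
    exact Derives.prop_mono i0.1 i1 i2
  | prop_true _ _ i0 i1 =>
    exact Derives.prop_true i0.1 i1
  | bot_form _ i0 =>
    exact .prop .small (bot_prop i0) stableProp_bot
  | bot_elim _ _ i0 i1 =>
    exact Derives.bot_elim i0.1 i1
  | and_form s _ _ i0 i1 =>
    exact .prop s (.and_form .large (s.prop i0.1) (s.prop i1.1))
      (stableProp_and (s.prop i0.1) (s.prop i1.1) (i0.2.2 s.pr_isProp) (i1.2.2 s.pr_isProp))
  | and_cong s _ _ i0 i1 =>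
    exact Derives.and_cong s i0 i1
  | and_intro _ _ _ _ i0 i1 i2 i3 =>
    exact Derives.and_intro i0.1 i1.1 i2 i3
  | and_left _ _ _ i0 i1 i2 =>
    exact Derives.and_left i0.1 i1.1 i2
  | and_right _ _ _ i0 i1 i2 =>
    exact Derives.and_right i0.1 i1.1 i2
  | or_form s _ _ i0 i1 =>
    have h := neg_prop (or_prop (s.prop i0.1) (s.prop i1.1))
    exact .prop s (neg_prop h) (stableProp_neg h)
  | or_cong s _ _ i0 i1 =>
    exact neg_cong s (neg_cong s (.or_cong s i0 i1))
  | or_left _ _ _ i0 i1 i2 =>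
    exact nn_intro (or_prop i0.1 i1.1) (.or_left i0.1 i1.1 i2)
  | or_right _ _ _ i0 i1 i2 =>
    exact nn_intro (or_prop i0.1 i1.1) (.or_right i0.1 i1.1 i2)
  | or_elim _ _ _ _ _ _ i0 i1 i2 i3 i4 i5 =>
    simp only [Interp, Ctx.dn, List.map_cons, Expr.dn, dn_wk] at i0 i1 i2 i3 i4 i5 ⊢
    -- Stability of the conclusion, carried along in the induction, is what validates elimination
    -- from a double-negated disjunction; the existential case is alike.
    exact nn_or_elim i0.1 i1.1 i2.1 (i2.2.2 (.inr rfl)) i3 i4 i5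
  | imp_form s _ _ i0 i1 =>
    exact .prop s (imp_prop (s.prop i0.1) (s.prop i1.1))
      (stableProp_imp (s.prop i0.1) (s.prop i1.1) (i1.2.2 s.pr_isProp))
  | imp_cong s _ _ i0 i1 =>
    exact Derives.imp_cong s i0 i1
  | imp_intro _ _ _ i0 i1 i2 =>
    simp only [Interp, Ctx.dn, List.map_cons, Expr.dn, dn_wk] at i0 i1 i2 ⊢
    exact .imp_intro i0.1 i1.1 i2
  | imp_elim _ _ _ _ i0 i1 i2 i3 =>
    exact Derives.imp_elim i0.1 i1.1 i2 i3
  | ex_form s _ _ i0 i1 =>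
    have h := neg_prop (ex_prop (s.col i0.1) (s.prop i1.1))
    exact .prop s (neg_prop h) (stableProp_neg h)
  | ex_cong s _ _ i0 i1 =>
    exact neg_cong s (neg_cong s (.ex_cong s i0 i1))
  | ex_intro _ _ _ _ i0 i1 i2 i3 =>
    simp only [Interp, Ctx.dn, List.map_cons, Expr.dn, dn_inst] at i0 i1 i2 i3 ⊢
    exact nn_intro (ex_prop i0.1 i1.1) (.ex_intro i0.1 i1.1 i2 i3)
  | ex_elim _ _ _ _ _ i0 i1 i2 i3 i4 =>
    simp only [Interp, Ctx.dn, List.map_cons, Expr.dn, dn_wk] at i0 i1 i2 i3 i4 ⊢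
    exact nn_ex_elim i0.1 i1.1 i2.1 (i2.2.2 (.inr rfl)) i3 i4
  | all_form s _ _ i0 i1 =>
    exact .prop s (.all_form .large (s.col i0.1) (s.prop i1.1))
      (stableProp_all (s.col i0.1) (s.prop i1.1) (i1.2.2 s.pr_isProp))
  | all_cong s _ _ i0 i1 =>
    simp only [Interp, Ctx.dn, List.map_cons, Expr.dn] at i0 i1 ⊢
    exact .all_cong s i0 i1
  | all_intro _ _ _ i0 i1 i2 =>
    simp only [Interp, Ctx.dn, List.map_cons, Expr.dn] at i0 i1 i2 ⊢
    exact .all_intro i0.1 i1.1 i2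
  | all_elim _ _ _ _ i0 i1 i2 i3 =>
    simp only [Interp, Ctx.dn, List.map_cons, Expr.dn, dn_inst] at i0 i1 i2 i3 ⊢
    exact .all_elim i0.1 i1.1 i2 i3
  | eq_form s _ _ _ i0 i1 i2 =>
    exact .prop s (eq_prop (s.col i0.1) i1 i2) (stableProp_eq i0.2.1 (s.col i0.1) i1 i2)
  | eq_cong s _ _ _ i0 i1 i2 =>
    exact Derives.eq_cong s i0 i1 i2
  | eq_intro _ _ i0 i1 =>
    exact Derives.eq_intro i0.1 i1
  | eq_elim _ _ _ _ i0 i1 i2 i3 =>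
    exact Derives.eq_elim i0.1 i1 i2 i3
  | lem _ _ i1 =>
    exact nn_em i1.1

/-- A contradiction passes upwards by inclusion of theories, and downwards because the translation
fixes the judgement `true ∈ ⊥ [ ]`. -/
theorem equiconsistent_emTTcImp_emTTImp : Equiconsistent emTTcImp emTTImp :=
  ⟨fun h hb => h (hb.mono (by simp [emTTImp]) fun _ => rfl), fun h hb => h hb.interp.derives⟩

end EmTT

theorem propositiona6 :
    EmTT.Equiconsistent EmTT.emTTcImp EmTT.emTTImp ∧
    (∀ J : EmTT.Judgement,
      EmTT.Derives EmTT.emTTcImp J → EmTT.Derives EmTT.emTTImp J.dn) ∧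
    (∀ (Γ : EmTT.Ctx) (φ : EmTT.Expr),
      EmTT.Derives EmTT.emTTcImp (.typ Γ .prop φ) →
        EmTT.Stable EmTT.emTTImp (EmTT.Ctx.dn Γ) φ.dn) ∧
    (∀ (Γ : EmTT.Ctx) (A : EmTT.Expr),
      EmTT.Derives EmTT.emTTcImp (.typ Γ .col A) →
        EmTT.StableEq EmTT.emTTImp (EmTT.Ctx.dn Γ) A.dn) :=
  ⟨EmTT.equiconsistent_emTTcImp_emTTImp, fun _ h => h.interp.derives,
    fun _ _ h => (h.interp.2.2 (.inr rfl)).stable h.interp.1,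
    fun _ _ h => h.interp.2.1.stableEq h.interp.1⟩
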